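/- **Setting.** Let $\mathcal T^h$ be a finite conforming mesh of axis-parallel rectangles (no overlaps, no hanging nodes) whose union is $\overline\Omega\subset\mathbb R^2$. Let $\mathcal T^H$ be a coarse mesh whose blocks $K$ are connected unions of fine cells, every fine cell lying in exactly one block. Let $h,H,\gamma>0$ be the fine mesh size, the coarse mesh size and the penalty parameter (the estimates hold for arbitrary positive values of $h$ and $H$). Let $a$ be measurable with $0<a_0\le a\le a_1$ on $\overline\Omega$. For a union $S$ of fine cells let $V_h(S)$ be the space of continuous functions on $S$ that are bilinear on every fine cell of $S$, and let $V_h^0(S)$ be the subspace of functions vanishing on $\partial S$; put $V_h=V_h^0(\overline\Omega)$. Let $f(t)\in L^2(\Omega)$ for $t\in[0,T]$, $T>0$, and let $u_h:[0,T]\to V_h$ be twice differentiable in time with $$((u_h)_{tt},v)+\int_\Omega a\nabla u_h\cdot\nabla v=(f,v)\qquad\forall v\in V_h,\ t\in[0,T].$$ For a function $U$ given by $U|_K$ on every coarse block $K$ let $$\|U\|_a^2=\sum_K\int_K a|\nabla U|^2+\frac{\gamma}{h}\sum_e\int_e a\,[U]_e^2,$$ where $e$ runs over the coarse edges, $[U]_e$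 is the jump across $e$ if $e$ is interior, and $[U]_e=U$ if $e\subset\partial\Omega$. **Local modes.** For a block $K$ let $V_H^1(K)$ be the span of the functions $w_{x}\in V_h(K)$, $x$ a fine node on $\partial K$, such that $w_x(x)=1$, $w_x=0$ at the other fine nodes on $\partial K$, and $\int_Ka\nabla w_x\cdot\nabla v=0$ for all $v\in V_h^0(K)$. Let $\mu_{1,K}\le\dots\le\mu_{n_K,K}$ and $\widetilde w_{i,K}$ be the eigenvalues and an eigenbasis, orthonormal in $L^2(\partial K)$, of $$\int_K a\nabla w\cdot\nabla v=\frac{\mu}{H}\int_{\partial K}wv\qquad\forall v\in V_H^1(K),\quad w\in V_H^1(K),$$ and let $\lambda_{1,K}\le\dots\le\lambda_{n_{0,K},K}$ and $z_{i,K}$ be the eigenvalues and an eigenbasis, orthonormal in $L^2(K)$, of $$\int_K a\nabla z\cdot\nabla v=\frac{\lambda}{H^2}\int_{K}zv\qquad\forall v\in V_h^0(K),\quad z\in V_h^0(K).$$ **Theorem.** Fix $t\in[0,T]$. There are coefficients with, on every block $K$, $$u_h=\sum_{i=1}^{n_K}c_{i,K}\widetilde w_{i,K}+\sum_{i=1}^{n_{0,K}}d_{i,K}z_{i,K}=:u_1+u_2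 .$$ For all such coefficients, there is on every $\partial K$ a variational normal flux $a\frac{\partial u_1}{\partial n}$, that is, the restriction to $\partial K$ of a function in $V_h(K)$ such that $$\int_{\partial K}a\frac{\partial u_1}{\partial n}\,v=\int_K a\nabla u_1\cdot\nabla v\qquad\forall v\in V_h(K).$$ Let $1\le p_K\le n_K$ and $0\le m_K\le n_{0,K}$ for every $K$ (for example the same $p$ and $m$ for all $K$), write $p=p_K$, $m=m_K$, and let $$\phi|_K=\sum_{i=1}^{p}c_{i,K}\widetilde w_{i,K}+\sum_{i=1}^{m}d_{i,K}z_{i,K}.$$ Then $$\|u_h-\phi\|_a^2\le\sum_{K\in\mathcal T^H}\Big(\frac{H}{\mu_{p+1,K}}\Big(1+\frac{2a_1\gamma H}{h\,\mu_{p+1,K}}\Big)\int_{\partial K}\Big(a\frac{\partial u_1}{\partial n}\Big)^2+\frac{H^2}{\lambda_{m+1,K}}\|f-(u_h)_{tt}\|_{L^2(K)}^2\Big),$$ where $1/\mu_{n_K+1,K}$ and $1/\lambda_{n_{0,K}+1,K}$ are read as $0$. Consequently the squared error is $O(\mu_{p+1,K}^{-1}+\lambda_{m+1,K}^{-1})$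 with constants that do not depend on the numbers of modes: $$\|u_h-\phi\|_a^2\le\sum_{K\in\mathcal T^H}\Big(\frac{A_K}{\mu_{p+1,K}}+\frac{B_K}{\lambda_{m+1,K}}\Big),$$ with $A_K=H\big(1+\frac{2a_1\gamma H}{h\mu_{2,K}}\big)\int_{\partial K}\big(a\frac{\partial u_1}{\partial n}\big)^2$ and $B_K=H^2\|f-(u_h)_{tt}\|_{L^2(K)}^2$. -/

import Mathlib

open MeasureTheory Set

noncomputable section

namespace GMsFEM

/-- A nondegenerate axis-parallel rectangle `[x₀, x₁] × [y₀, y₁]` in the plane. -/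
structure Rect where
  x₀ : ℝ
  x₁ : ℝ
  y₀ : ℝ
  y₁ : ℝ
  hx : x₀ < x₁
  hy : y₀ < y₁

/-- The closed rectangle as a set of points. -/
def Rect.carrier (R : Rect) : Set (ℝ × ℝ) := Icc R.x₀ R.x₁ ×ˢ Icc R.y₀ R.y₁

/-- The four vertices of a rectangle. -/
def Rect.corners (R : Rect) : Set (ℝ × ℝ) := {R.x₀, R.x₁} ×ˢ {R.y₀, R.y₁}

/-- The closed region covered by a finite set of rectangles. -/
def region (S : Finset Rect) : Set (ℝ × ℝ) := ⋃ R ∈ S, R.carrier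

/-- A conforming fine mesh: finitely many rectangles without overlap and without hanging nodes
(a vertex of one cell that lies in another cell is a vertex of that cell as well; equivalently,
two distinct cells meet in the empty set, in a common vertex or in a common full edge).
The closure of the domain `Ω` is `region cells`, and `∂Ω` is `frontier (region cells)`. -/
structure FineMesh where
  cells : Finset Rect
  interior_disjoint : ∀ R ∈ cells, ∀ R' ∈ cells, R ≠ R' →
    Disjoint (interior R.carrier) (interior R'.carrier)
  no_hanging_nodes : ∀ R ∈ cells, ∀ R' ∈ cells, R'.corners ∩ R.carrier ⊆ R.corners

/-- A coarse mesh on top of a fine mesh: the blocks `K` are nonempty, connected unions of fine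
cells, and every fine cell belongs to exactly one block. -/
structure IsCoarseMesh {ι : Type*} (M : FineMesh) (block : ι → Finset Rect) : Prop where
  subset : ∀ k, block k ⊆ M.cells
  connected : ∀ k, IsConnected (region (block k))
  partition : ∀ R ∈ M.cells, ∃! k, R ∈ block k

/-- The conforming bilinear finite element space on the union of the cells in `S`: functions that
are continuous on this closed region and bilinear on every cell. A function on the region is
represented by its extension by zero to the plane. For a coarse block `K` this is `V_h(K)`. -/
def femSpace (S : Finset Rect) : Submodule ℝ (ℝ × ℝ → ℝ) where
  carrier := {u | ContinuousOn u (region S) ∧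
    (∀ R ∈ S, ∃ α β δ ε : ℝ, ∀ x ∈ R.carrier,
      u x = α + β * x.1 + δ * x.2 + ε * (x.1 * x.2)) ∧
    ∀ x, x ∉ region S → u x = 0}
  add_mem' := by
    rintro u v ⟨hu, hu', hu''⟩ ⟨hv, hv', hv''⟩
    refine ⟨hu.add hv, fun R hR => ?_, fun x hx => ?_⟩
    · obtain ⟨α, β, δ, ε, h⟩ := hu' R hR
      obtain ⟨α', β', δ', ε', h'⟩ := hv' R hR
      refine ⟨α + α', β + β', δ + δ', ε + ε', fun x hx => ?_⟩
      simp only [Pi.add_apply, h x hx, h' x hx]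
      ring
    · simp [hu'' x hx, hv'' x hx]
  zero_mem' := ⟨continuousOn_const, fun _ _ => ⟨0, 0, 0, 0, by simp⟩, fun _ _ => rfl⟩
  smul_mem' := by
    rintro r u ⟨hu, hu', hu''⟩
    refine ⟨hu.const_smul r, fun R hR => ?_, fun x hx => ?_⟩
    · obtain ⟨α, β, δ, ε, h⟩ := hu' R hR
      refine ⟨r * α, r * β, r * δ, r * ε, fun x hx => ?_⟩
      simp only [Pi.smul_apply, smul_eq_mul, h x hx]
      ring
    · simp [hu'' x hx]

/-- The finite element functions that vanish on the boundary of the region. For a coarse block `K`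
this is `V_h^0(K)`; for all cells of the fine mesh it is the global space `V_h` with the
homogeneous Dirichlet condition on `∂Ω`. -/
def femSpaceZero (S : Finset Rect) : Submodule ℝ (ℝ × ℝ → ℝ) where
  carrier := {u | u ∈ femSpace S ∧ ∀ x ∈ frontier (region S), u x = 0}
  add_mem' := by
    rintro u v ⟨hu, hu'⟩ ⟨hv, hv'⟩
    exact ⟨add_mem hu hv, fun x hx => by simp [hu' x hx, hv' x hx]⟩
  zero_mem' := ⟨zero_mem _, fun _ _ => rfl⟩
  smul_mem' := by
    rintro r u ⟨hu, hu'⟩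
    exact ⟨Submodule.smul_mem _ r hu, fun x hx => by simp [hu' x hx]⟩

/-- The energy form `∫_K a ∇u · ∇v` over the union `K` of the cells in `S`. (The functions it is
applied to are smooth in the interior of every cell, and the cell edges are Lebesgue null sets.) -/
def energy (a : ℝ × ℝ → ℝ) (S : Finset Rect) (u v : ℝ × ℝ → ℝ) : ℝ :=
  ∫ x in region S, a x *
    (fderiv ℝ u x (1, 0) * fderiv ℝ v x (1, 0) + fderiv ℝ u x (0, 1) * fderiv ℝ v x (0, 1))

/-- Line integral over a set made of axis-parallel segments, with respect to arc length. (On such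
a set the one-dimensional Hausdorff measure of the product metric of `ℝ × ℝ` is arc length.) -/
def lineIntegral (Γ : Set (ℝ × ℝ)) (g : ℝ × ℝ → ℝ) : ℝ :=
  ∫ x in Γ, g x ∂(Measure.hausdorffMeasure 1)

/-- The integral over the boundary `∂K` of the union `K` of the cells in `S`. -/
def bdryIntegral (S : Finset Rect) (g : ℝ × ℝ → ℝ) : ℝ :=
  lineIntegral (frontier (region S)) g

/-- The fine grid nodes on `∂K`. -/
def bdryNodes (S : Finset Rect) : Set (ℝ × ℝ) :=
  {x | x ∈ frontier (region S) ∧ ∃ R ∈ S, x ∈ R.corners}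

/-- `w` is the discrete `a`-harmonic extension of the unit boundary function of the node `x`:
`w = 1` at `x`, `w = 0` at the other nodes on `∂K`, and `∫_K a ∇w · ∇v = 0` for all
`v ∈ V_h^0(K)`. -/
structure IsNodalHarmonicExtension (a : ℝ × ℝ → ℝ) (S : Finset Rect) (x : ℝ × ℝ)
    (w : ℝ × ℝ → ℝ) : Prop where
  mem : w ∈ femSpace S
  node : w x = 1
  other : ∀ y ∈ bdryNodes S, y ≠ x → w y = 0
  harmonic : ∀ v ∈ femSpaceZero S, energy a S w v = 0

/-- The snapshot space `V_H^1(K)`: the span of the discrete `a`-harmonic extensions of the unit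
boundary functions of all fine grid nodes on `∂K`. -/
def snapshotSpace (a : ℝ × ℝ → ℝ) (S : Finset Rect) : Submodule ℝ (ℝ × ℝ → ℝ) :=
  Submodule.span ℝ {w | ∃ x ∈ bdryNodes S, IsNodalHarmonicExtension a S x w}

/-- A complete ordered system of eigenpairs of the Steklov-type problem on the snapshot space,
`∫_K a ∇w · ∇v = (μ / H) ∫_{∂K} w v` for all `v ∈ V_H^1(K)`, orthonormal in `L²(∂K)`. The index
`i : Fin n` stands for the mode number `i + 1`. -/
structure IsBoundaryEigensystem (a : ℝ × ℝ → ℝ) (H : ℝ) (S : Finset Rect) {n : ℕ}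
    (μ : Fin n → ℝ) (w : Fin n → ℝ × ℝ → ℝ) : Prop where
  ordered : Monotone μ
  span_eq : Submodule.span ℝ (range w) = snapshotSpace a S
  orthonormal : ∀ i j, bdryIntegral S (fun x => w i x * w j x) = if i = j then 1 else 0
  eigen : ∀ i, ∀ v ∈ snapshotSpace a S,
    energy a S (w i) v = μ i / H * bdryIntegral S (fun x => w i x * v x)

/-- A complete ordered system of eigenpairs of the interior Dirichlet problem,
`∫_K a ∇z · ∇v = (ev / H²) ∫_K z v` for all `v ∈ V_h^0(K)`, orthonormal in `L²(K)`. The index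
`i : Fin n` stands for the mode number `i + 1`. -/
structure IsInteriorEigensystem (a : ℝ × ℝ → ℝ) (H : ℝ) (S : Finset Rect) {n : ℕ}
    (ev : Fin n → ℝ) (z : Fin n → ℝ × ℝ → ℝ) : Prop where
  ordered : Monotone ev
  span_eq : Submodule.span ℝ (range z) = femSpaceZero S
  orthonormal : ∀ i j, ∫ x in region S, z i x * z j x = if i = j then 1 else 0
  eigen : ∀ i, ∀ v ∈ femSpaceZero S,
    energy a S (z i) v = ev i / H ^ 2 * ∫ x in region S, z i x * v x

/-- The reciprocal of the eigenvalue number `k + 1`; it is `0` if there are only `k` or fewer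
eigenvalues (all modes are then used and the next eigenvalue counts as infinite). -/
def recipNext {n : ℕ} (ev : Fin n → ℝ) (k : ℕ) : ℝ :=
  if hk : k < n then 1 / ev ⟨k, hk⟩ else 0

/-- The semidiscrete finite element solution: `u t ∈ V_h`, twice differentiable in time on
`[0, T]` with derivatives `ut`, `utt`, and `(utt, v) + a(u, v) = (f, v)` for all `v ∈ V_h`. -/
structure IsSemidiscreteSolution (M : FineMesh) (a : ℝ × ℝ → ℝ) (T : ℝ)
    (f u ut utt : ℝ → ℝ × ℝ → ℝ) : Prop where
  mem : ∀ t ∈ Icc 0 T, u t ∈ femSpaceZero M.cells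
  deriv_one : ∀ t ∈ Icc 0 T, ∀ x, HasDerivWithinAt (fun s => u s x) (ut t x) (Icc 0 T) t
  deriv_two : ∀ t ∈ Icc 0 T, ∀ x, HasDerivWithinAt (fun s => ut s x) (utt t x) (Icc 0 T) t
  eqn : ∀ t ∈ Icc 0 T, ∀ v ∈ femSpaceZero M.cells,
    (∫ x in region M.cells, utt t x * v x) + energy a M.cells (u t) v
      = ∫ x in region M.cells, f t x * v x

/-- `q` is the normal flux `a ∂u/∂n` on `∂K` of a finite element function `u`, in the variational
sense: `q` is the restriction to `∂K` of a function in `V_h(K)`, and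
`∫_{∂K} q v = ∫_K a ∇u · ∇v` for all `v ∈ V_h(K)`. -/
structure IsNormalFlux (a : ℝ × ℝ → ℝ) (S : Finset Rect) (u q : ℝ × ℝ → ℝ) : Prop where
  trace : ∃ g ∈ femSpace S, EqOn q g (frontier (region S))
  green : ∀ v ∈ femSpace S, bdryIntegral S (fun x => q x * v x) = energy a S u v

/-- The square of the broken norm `‖U‖_a` of a function given on every coarse block `k` by `U k`.
The interior coarse edges are the interfaces of two distinct blocks; each of them is counted twice
in the double sum (whence the factor `1 / 2`), whose diagonal terms vanish. On the coarse edges on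
`∂Ω` the jump is the function itself. -/
def aNormSq {ι : Type*} [Fintype ι] (M : FineMesh) (block : ι → Finset Rect) (a : ℝ × ℝ → ℝ)
    (γ h : ℝ) (U : ι → ℝ × ℝ → ℝ) : ℝ :=
  (∑ k, energy a (block k) (U k) (U k)) + γ / h *
    ((1 / 2) * (∑ k, ∑ l, lineIntegral (region (block k) ∩ region (block l))
        (fun x => a x * (U k x - U l x) ^ 2)) +
      ∑ k, lineIntegral (region (block k) ∩ frontier (region M.cells))
        (fun x => a x * (U k x) ^ 2))

/-- The combination `∑_{i ≤ p} c_i e_i` of the first `p` modes. -/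
def modalSum {n : ℕ} (p : ℕ) (c : Fin n → ℝ) (e : Fin n → ℝ × ℝ → ℝ) : ℝ × ℝ → ℝ :=
  ∑ i with i.val < p, c i • e i

/-- `c`, `d` are the coefficients of the expansion of `u` on the region of `S` in the boundary
modes `w` and the interior modes `z`. -/
def IsModalExpansion (S : Finset Rect) {n n₀ : ℕ} (w : Fin n → ℝ × ℝ → ℝ)
    (z : Fin n₀ → ℝ × ℝ → ℝ) (u : ℝ × ℝ → ℝ) (c : Fin n → ℝ) (d : Fin n₀ → ℝ) : Prop :=
  ∀ x ∈ region S, u x = modalSum n c w x + modalSum n₀ d z x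

end GMsFEM

end

noncomputable section

namespace GMsFEM

/-! ### Geometry of rectangles and conforming meshes -/

/-! On a block $K$ the space $V_h(K)$ is the energy-orthogonal sum of the discrete harmonic
functions and $V_h^0(K)$ (`exists_modal_expansion`, `IsAdmissible.energy_snapshotSpace`). Each
eigenbasis diagonalises its energy form and is orthonormal in $L^2(\partial K)$ or $L^2(K)$. So the
expansion coefficients, multiplied by the scaled eigenvalues, are Fourier coefficients of data:
testing the flux $q$ with a boundary mode gives $c_i\mu_i/H=\int_{\partial K}q\,\widetilde w_i$, and
testing the semidiscrete equation with an interior mode, extended by zero, gives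
$d_i\lambda_i/H^2=\int_K(f-u_{tt})z_i$.

Bessel's inequality then bounds the tails (`sum_tail_le`). The energy of a tail costs one factor
$1/\mu_{p+1}$ or $1/\lambda_{m+1}$; the $L^2(\partial K)$ norm of the boundary tail costs
$1/\mu_{p+1}^2$. Interior modes vanish on $\partial K$, so the jumps see only the boundary tail, and
the penalty is at most $2a_1\gamma/h$ times the sum of these squared traces
(`IsCoarseMesh.jump_le`). This produces the factor $1+2a_1\gamma H/(h\mu_{p+1})$.

Dividing by the eigenvalues requires positivity. By connectedness, zero energy means constant, so
every $\lambda_i$ is positive and at most $\mu_1$ vanishes; this is why $p\ge1$. Conformity of the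
mesh supplies the rest: nodal values determine traces, local functions extend by zero, and different
boundary parts of a block meet only at vertices. -/

theorem Rect.mem_carrier {R : Rect} {z : ℝ × ℝ} :
    z ∈ R.carrier ↔ (R.x₀ ≤ z.1 ∧ z.1 ≤ R.x₁) ∧ (R.y₀ ≤ z.2 ∧ z.2 ≤ R.y₁) := Iff.rfl

theorem Rect.mem_corners {R : Rect} {z : ℝ × ℝ} :
    z ∈ R.corners ↔ (z.1 = R.x₀ ∨ z.1 = R.x₁) ∧ (z.2 = R.y₀ ∨ z.2 = R.y₁) := Iff.rfl

theorem Rect.interior_carrier (R : Rect) :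
    interior R.carrier = Ioo R.x₀ R.x₁ ×ˢ Ioo R.y₀ R.y₁ := by
  rw [Rect.carrier, interior_prod_eq, interior_Icc, interior_Icc]

theorem Rect.mem_interior {R : Rect} {z : ℝ × ℝ} :
    z ∈ interior R.carrier ↔ (R.x₀ < z.1 ∧ z.1 < R.x₁) ∧ (R.y₀ < z.2 ∧ z.2 < R.y₁) := by
  rw [R.interior_carrier]; rfl

theorem Rect.isCompact_carrier (R : Rect) : IsCompact R.carrier := isCompact_Icc.prod isCompact_Icc

theorem Rect.isClosed_carrier (R : Rect) : IsClosed R.carrier := R.isCompact_carrier.isClosed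

theorem Rect.closure_interior (R : Rect) : closure (interior R.carrier) = R.carrier := by
  rw [R.interior_carrier, closure_prod_eq, closure_Ioo R.hx.ne, closure_Ioo R.hy.ne, Rect.carrier]

theorem Rect.finite_corners (R : Rect) : R.corners.Finite :=
  (Set.toFinite _).prod (Set.toFinite _)

theorem Rect.corners_subset (R : Rect) : R.corners ⊆ R.carrier := by
  intro z hz
  have := R.hx.le
  have := R.hy.le
  rw [Rect.mem_corners] at hz
  rw [Rect.mem_carrier]
  rcases hz with ⟨h | h, h' | h'⟩ <;> rw [h, h'] <;> simp [*]

theorem carrier_subset_region {S : Finset Rect} {R : Rect} (hR : R ∈ S) :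
    R.carrier ⊆ region S := subset_biUnion_of_mem (u := fun R : Rect => R.carrier) hR

theorem mem_region {S : Finset Rect} {z : ℝ × ℝ} : z ∈ region S ↔ ∃ R ∈ S, z ∈ R.carrier := by
  simp [region]

theorem region_mono {S S' : Finset Rect} (h : S ⊆ S') : region S ⊆ region S' :=
  biUnion_subset_biUnion_left h

theorem isCompact_region (S : Finset Rect) : IsCompact (region S) :=
  S.finite_toSet.isCompact_biUnion fun R _ => R.isCompact_carrier

theorem isClosed_region (S : Finset Rect) : IsClosed (region S) := (isCompact_region S).isClosed

theorem measurableSet_region (S : Finset Rect) : MeasurableSet (region S) :=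
  (isClosed_region S).measurableSet

theorem frontier_subset_region (S : Finset Rect) : frontier (region S) ⊆ region S :=
  (isClosed_region S).frontier_subset

theorem frontier_region_nonempty {S : Finset Rect} (h : (region S).Nonempty) :
    (frontier (region S)).Nonempty := by
  rw [nonempty_iff_ne_empty, Ne, frontier_eq_empty_iff, not_or]
  exact ⟨h.ne_empty, (isCompact_region S).ne_univ⟩

variable {M : FineMesh}

/-- The interior of a cell is disjoint from every other cell. -/
theorem FineMesh.notMem_interior {R R' : Rect} (hR : R ∈ M.cells) (hR' : R' ∈ M.cells)
    (hne : R ≠ R') {z : ℝ × ℝ} (hz : z ∈ R'.carrier) : z ∉ interior R.carrier := by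
  intro h
  rw [← R'.closure_interior] at hz
  obtain ⟨y, hy, hy'⟩ := mem_closure_iff.1 hz _ isOpen_interior h
  exact (M.interior_disjoint R hR R' hR' hne).le_bot ⟨hy, hy'⟩

/-- Conformity in one dimension. Both intervals contain `z`, so the larger left endpoint lies in the
other interval and is an endpoint of it. It cannot be the right one, because `z` is strictly inside
`[s, t]`; hence the left endpoints agree, and the right ones by symmetry. -/
theorem endpoints_eq_of_no_hanging {s t s' t' z : ℝ} (hs : s < z) (ht : z < t) (hs' : s' ≤ z)
    (ht' : z ≤ t') (h : ∀ Y, Y = s' ∨ Y = t' → s ≤ Y → Y ≤ t → Y = s ∨ Y = t)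
    (h' : ∀ Y, Y = s ∨ Y = t → s' ≤ Y → Y ≤ t' → Y = s' ∨ Y = t') : s = s' ∧ t = t' := by
  have h1 := h s' (.inl rfl)
  have h2 := h t' (.inr rfl)
  have h3 := h' s (.inl rfl)
  have h4 := h' t (.inr rfl)
  constructor <;> grind

/-- Two cells that share a point which is not a vertex share the edge around this point. -/
theorem FineMesh.shared_edge {R R' : Rect} (hR : R ∈ M.cells) (hR' : R' ∈ M.cells) (hne : R ≠ R')
    {z : ℝ × ℝ} (hz : z ∈ R.carrier) (hz' : z ∈ R'.carrier) (hc : z ∉ R.corners) :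
    ((z.1 = R.x₀ ∧ R.x₀ = R'.x₁ ∨ z.1 = R.x₁ ∧ R.x₁ = R'.x₀) ∧
      R.y₀ = R'.y₀ ∧ R.y₁ = R'.y₁ ∧ R.y₀ < z.2 ∧ z.2 < R.y₁) ∨
    ((z.2 = R.y₀ ∧ R.y₀ = R'.y₁ ∨ z.2 = R.y₁ ∧ R.y₁ = R'.y₀) ∧
      R.x₀ = R'.x₀ ∧ R.x₁ = R'.x₁ ∧ R.x₀ < z.1 ∧ z.1 < R.x₁) := by
  have hn : ∀ X Y, (X = R'.x₀ ∨ X = R'.x₁) → (Y = R'.y₀ ∨ Y = R'.y₁) → R.x₀ ≤ X → X ≤ R.x₁ →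
      R.y₀ ≤ Y → Y ≤ R.y₁ → (X = R.x₀ ∨ X = R.x₁) ∧ (Y = R.y₀ ∨ Y = R.y₁) :=
    fun X Y h1 h2 h3 h4 h5 h6 =>
      M.no_hanging_nodes R hR R' hR' (a := (X, Y)) ⟨⟨h1, h2⟩, ⟨h3, h4⟩, h5, h6⟩
  have hn' : ∀ X Y, (X = R.x₀ ∨ X = R.x₁) → (Y = R.y₀ ∨ Y = R.y₁) → R'.x₀ ≤ X → X ≤ R'.x₁ →
      R'.y₀ ≤ Y → Y ≤ R'.y₁ → (X = R'.x₀ ∨ X = R'.x₁) ∧ (Y = R'.y₀ ∨ Y = R'.y₁) :=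
    fun X Y h1 h2 h3 h4 h5 h6 =>
      M.no_hanging_nodes R' hR' R hR (a := (X, Y)) ⟨⟨h1, h2⟩, ⟨h3, h4⟩, h5, h6⟩
  rw [Rect.mem_carrier] at hz hz'
  obtain ⟨⟨a1, a2⟩, a3, a4⟩ := hz
  obtain ⟨⟨b1, b2⟩, b3, b4⟩ := hz'
  rw [Rect.mem_corners] at hc
  -- If no opposite sides touched at `z`, the projections to both axes would overlap in open
  -- intervals, and the cells would share an interior point.
  have hd : (R.x₀ = R'.x₁ ∧ z.1 = R.x₀ ∨ R.x₁ = R'.x₀ ∧ z.1 = R.x₁) ∨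
      (R.y₀ = R'.y₁ ∧ z.2 = R.y₀ ∨ R.y₁ = R'.y₀ ∧ z.2 = R.y₁) := by
    by_contra hcon
    have e1 : max R.x₀ R'.x₀ < min R.x₁ R'.x₁ := by
      have := R.hx
      have := R'.hx
      rw [max_lt_iff, lt_min_iff, lt_min_iff]
      grind
    have e2 : max R.y₀ R'.y₀ < min R.y₁ R'.y₁ := by
      have := R.hy
      have := R'.hy
      rw [max_lt_iff, lt_min_iff, lt_min_iff]
      grind
    obtain ⟨X, hX, hX'⟩ := exists_between e1
    obtain ⟨Y, hY, hY'⟩ := exists_between e2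
    rw [max_lt_iff] at hX hY
    rw [lt_min_iff] at hX' hY'
    refine disjoint_left.1 (M.interior_disjoint R hR R' hR' hne) (?_ : (X, Y) ∈ _) ?_
    · exact Rect.mem_interior.2 ⟨⟨hX.1, hX'.1⟩, hY.1, hY'.1⟩
    · exact Rect.mem_interior.2 ⟨⟨hX.2, hX'.2⟩, hY.2, hY'.2⟩
  rcases hd with hx | hy
  · left
    have hy0 : R.y₀ < z.2 := lt_of_le_of_ne a3 (by grind)
    have hy1 : z.2 < R.y₁ := lt_of_le_of_ne a4 (by grind)
    have := endpoints_eq_of_no_hanging hy0 hy1 b3 b4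
      (fun Y h1 h2 h3 => (hn z.1 Y (by grind) h1 a1 a2 h2 h3).2)
      (fun Y h1 h2 h3 => (hn' z.1 Y (by grind) h1 b1 b2 h2 h3).2)
    grind
  · right
    have hx0 : R.x₀ < z.1 := lt_of_le_of_ne a1 (by grind)
    have hx1 : z.1 < R.x₁ := lt_of_le_of_ne a2 (by grind)
    have := endpoints_eq_of_no_hanging hx0 hx1 b1 b2
      (fun X h1 h2 h3 => (hn X z.2 h1 (by grind) h2 h3 a3 a4).1)
      (fun X h1 h2 h3 => (hn' X z.2 h1 (by grind) h2 h3 b3 b4).1)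
    grind

/-- A common point of two cells that is not a vertex is interior to their union. -/
theorem FineMesh.mem_interior_union {R R' : Rect} (hR : R ∈ M.cells) (hR' : R' ∈ M.cells)
    (hne : R ≠ R') {z : ℝ × ℝ} (hz : z ∈ R.carrier) (hz' : z ∈ R'.carrier) (hc : z ∉ R.corners) :
    z ∈ interior (R.carrier ∪ R'.carrier) := by
  have h1 := R.hx
  have h2 := R.hy
  have h3 := R'.hx
  have h4 := R'.hy
  have key : ∀ x₀ x₁ y₀ y₁ : ℝ, (x₀ < z.1 ∧ z.1 < x₁) ∧ (y₀ < z.2 ∧ z.2 < y₁) →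
      (∀ X Y, x₀ < X → X < x₁ → y₀ < Y → Y < y₁ →
        (X, Y) ∈ R.carrier ∪ R'.carrier) → z ∈ interior (R.carrier ∪ R'.carrier) := by
    intro x₀ x₁ y₀ y₁ hz hs
    exact mem_interior.2 ⟨Ioo x₀ x₁ ×ˢ Ioo y₀ y₁,
      fun y hy => hs y.1 y.2 hy.1.1 hy.1.2 hy.2.1 hy.2.2, isOpen_Ioo.prod isOpen_Ioo, hz⟩
  rcases M.shared_edge hR hR' hne hz hz' hc with ⟨⟨e, e'⟩ | ⟨e, e'⟩, f, f', g, g'⟩ |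
      ⟨⟨e, e'⟩ | ⟨e, e'⟩, f, f', g, g'⟩
  · apply key R'.x₀ R.x₁ R.y₀ R.y₁ (by grind)
    intro X Y _ _ _ _
    rw [mem_union, Rect.mem_carrier, Rect.mem_carrier]
    grind
  · apply key R.x₀ R'.x₁ R.y₀ R.y₁ (by grind)
    intro X Y _ _ _ _
    rw [mem_union, Rect.mem_carrier, Rect.mem_carrier]
    grind
  · apply key R.x₀ R.x₁ R'.y₀ R.y₁ (by grind)
    intro X Y _ _ _ _
    rw [mem_union, Rect.mem_carrier, Rect.mem_carrier]
    grind
  · apply key R.x₀ R.x₁ R.y₀ R'.y₁ (by grind)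
    intro X Y _ _ _ _
    rw [mem_union, Rect.mem_carrier, Rect.mem_carrier]
    grind

/-- A point of a union of cells that lies in a further cell is a boundary point of the union. -/
theorem FineMesh.mem_frontier_of_mem_other {S : Finset Rect} (hS : S ⊆ M.cells) {R : Rect}
    (hR : R ∈ M.cells) (hRS : R ∉ S) {z : ℝ × ℝ} (hz : z ∈ region S) (hz' : z ∈ R.carrier) :
    z ∈ frontier (region S) := by
  rw [(isClosed_region S).frontier_eq]
  refine ⟨hz, fun hi => ?_⟩
  rw [← R.closure_interior] at hz'
  obtain ⟨y, hy, hy'⟩ := mem_closure_iff.1 hz' _ isOpen_interior hi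
  obtain ⟨R', hR', hyR'⟩ := mem_region.1 (interior_subset hy)
  exact M.notMem_interior hR (hS hR') (by rintro rfl; exact hRS hR') hyR' hy'

/-- A point that lies in a single cell, but not in its interior, is a boundary point. -/
theorem mem_frontier_of_unique_cell {S : Finset Rect} {R : Rect} (hR : R ∈ S) {z : ℝ × ℝ}
    (hz : z ∈ R.carrier) (hzi : z ∉ interior R.carrier)
    (h : ∀ R' ∈ S, R' ≠ R → z ∉ R'.carrier) : z ∈ frontier (region S) := by
  rw [(isClosed_region S).frontier_eq]
  refine ⟨carrier_subset_region hR hz, fun hi => hzi ?_⟩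
  classical
  rw [mem_interior]
  -- The other cells form a closed set missing `z`; removing it from a neighbourhood inside the
  -- region leaves a neighbourhood inside `R`.
  refine ⟨interior (region S) ∩ (region (S.erase R))ᶜ, ?_,
    isOpen_interior.inter (isClosed_region _).isOpen_compl, hi, ?_⟩
  · rintro y ⟨hy, hy'⟩
    obtain ⟨R', hR', hyR'⟩ := mem_region.1 (interior_subset hy)
    by_cases e : R' = R
    · exact e ▸ hyR'
    · exact absurd (mem_region.2 ⟨R', Finset.mem_erase.2 ⟨e, hR'⟩, hyR'⟩) hy'
  · intro hz'
    obtain ⟨R', hR', hzR'⟩ := mem_region.1 hz'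
    exact h R' (Finset.mem_erase.1 hR').2 (Finset.mem_erase.1 hR').1 hzR'

/-- A boundary point which is not a vertex lies in a single cell. -/
theorem FineMesh.unique_cell {S : Finset Rect} (hS : S ⊆ M.cells) {R : Rect}
    (hR : R ∈ S) {z : ℝ × ℝ} (hz : z ∈ frontier (region S)) (hzR : z ∈ R.carrier)
    (hc : z ∉ R.corners) : ∀ R' ∈ S, R' ≠ R → z ∉ R'.carrier := by
  intro R' hR' hne hz'
  have h1 := M.mem_interior_union (hS hR) (hS hR') hne.symm hzR hz' hc
  have h2 : R.carrier ∪ R'.carrier ⊆ region S :=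
    union_subset (carrier_subset_region hR) (carrier_subset_region hR')
  rw [(isClosed_region S).frontier_eq] at hz
  exact hz.2 (interior_mono h2 h1)

/-- The set of all vertices of the cells in `S`. -/
def nodes (S : Finset Rect) : Set (ℝ × ℝ) := ⋃ R ∈ S, R.corners

theorem finite_nodes (S : Finset Rect) : (nodes S).Finite :=
  S.finite_toSet.biUnion fun R _ => R.finite_corners

theorem mem_nodes {S : Finset Rect} {z : ℝ × ℝ} : z ∈ nodes S ↔ ∃ R ∈ S, z ∈ R.corners := by
  simp [nodes]

theorem finite_bdryNodes (S : Finset Rect) : (bdryNodes S).Finite :=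
  (finite_nodes S).subset fun _ hx => mem_nodes.2 hx.2

/-- A boundary point which is not a vertex lies on an edge of the boundary whose endpoints are
boundary nodes. -/
theorem FineMesh.exists_boundary_edge {S : Finset Rect} (hS : S ⊆ M.cells) {R : Rect}
    (hR : R ∈ S) {z : ℝ × ℝ} (hz : z ∈ frontier (region S)) (hzR : z ∈ R.carrier)
    (hc : z ∉ R.corners) :
    ((z.1 = R.x₀ ∨ z.1 = R.x₁) ∧ (z.1, R.y₀) ∈ bdryNodes S ∧ (z.1, R.y₁) ∈ bdryNodes S) ∨
    ((z.2 = R.y₀ ∨ z.2 = R.y₁) ∧ (R.x₀, z.2) ∈ bdryNodes S ∧ (R.x₁, z.2) ∈ bdryNodes S) := by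
  have hu := M.unique_cell hS hR hz hzR hc
  have hx := R.hx
  have hy := R.hy
  have hzi : z ∉ interior R.carrier := by
    rw [(isClosed_region S).frontier_eq] at hz
    exact fun h => hz.2 (interior_mono (carrier_subset_region hR) h)
  rw [Rect.mem_interior] at hzi
  rw [Rect.mem_corners] at hc
  have hzR' := hzR
  rw [Rect.mem_carrier] at hzR
  by_cases hcx : z.1 = R.x₀ ∨ z.1 = R.x₁
  · left
    -- A second cell at any inner point of this edge would contain the full edge, hence `z`. So the
    -- open edge is in the frontier, and its endpoints follow by closedness.
    have hv : ∀ Y, R.y₀ < Y → Y < R.y₁ → (z.1, Y) ∈ frontier (region S) := by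
      intro Y h1 h2
      refine mem_frontier_of_unique_cell hR (Rect.mem_carrier.2 (by grind))
        (by rw [Rect.mem_interior]; grind) fun R' hR' hne hY => hu R' hR' hne ?_
      have := M.shared_edge (hS hR) (hS hR') hne.symm (z := (z.1, Y))
        (Rect.mem_carrier.2 (by grind)) hY (by rw [Rect.mem_corners]; grind)
      rw [Rect.mem_carrier] at hY ⊢
      grind
    have hcl : ∀ Y ∈ Icc R.y₀ R.y₁, (z.1, Y) ∈ frontier (region S) := by
      rw [← closure_Ioo hy.ne]
      have hcl : IsClosed ((fun Y => (z.1, Y)) ⁻¹' frontier (region S)) :=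
        isClosed_frontier.preimage (by fun_prop)
      exact fun Y hY => closure_minimal (fun Y hY => hv Y hY.1 hY.2) hcl hY
    exact ⟨hcx, ⟨hcl _ (left_mem_Icc.2 hy.le), R, hR, hcx, .inl rfl⟩,
      hcl _ (right_mem_Icc.2 hy.le), R, hR, hcx, .inr rfl⟩
  · right
    have hcy : z.2 = R.y₀ ∨ z.2 = R.y₁ := by grind
    have hv : ∀ X, R.x₀ < X → X < R.x₁ → (X, z.2) ∈ frontier (region S) := by
      intro X h1 h2
      refine mem_frontier_of_unique_cell hR (Rect.mem_carrier.2 (by grind))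
        (by rw [Rect.mem_interior]; grind) fun R' hR' hne hX => hu R' hR' hne ?_
      have := M.shared_edge (hS hR) (hS hR') hne.symm (z := (X, z.2))
        (Rect.mem_carrier.2 (by grind)) hX (by rw [Rect.mem_corners]; grind)
      rw [Rect.mem_carrier] at hX ⊢
      grind
    have hcl : ∀ X ∈ Icc R.x₀ R.x₁, (X, z.2) ∈ frontier (region S) := by
      rw [← closure_Ioo hx.ne]
      have hcl : IsClosed ((fun X => (X, z.2)) ⁻¹' frontier (region S)) :=
        isClosed_frontier.preimage (by fun_prop)
      exact fun X hX => closure_minimal (fun X hX => hv X hX.1 hX.2) hcl hX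
    exact ⟨hcy, ⟨hcl _ (left_mem_Icc.2 hx.le), R, hR, .inl rfl, hcy⟩,
      hcl _ (right_mem_Icc.2 hx.le), R, hR, .inr rfl, hcy⟩

/-- The boundary of a union of cells has finite length. -/
theorem hausdorffMeasure_frontier_region_lt_top (S : Finset Rect) :
    Measure.hausdorffMeasure 1 (frontier (region S)) < ⊤ := by
  have hv : ∀ X s t : ℝ, Measure.hausdorffMeasure 1 (({X} : Set ℝ) ×ˢ Icc s t) < ⊤ := by
    intro X s t
    -- In the product metric an axis-parallel segment is an isometric copy of a real interval, so
    -- its measure is its length.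
    have hi : Isometry fun Y : ℝ => (X, Y) := Isometry.of_dist_eq fun a b => by simp [Prod.dist_eq]
    rw [singleton_prod, hi.hausdorffMeasure_image (.inl zero_le_one), hausdorffMeasure_real]
    exact measure_Icc_lt_top
  have hh : ∀ Y s t : ℝ, Measure.hausdorffMeasure 1 (Icc s t ×ˢ ({Y} : Set ℝ)) < ⊤ := by
    intro Y s t
    have hi : Isometry fun X : ℝ => (X, Y) := Isometry.of_dist_eq fun a b => by simp [Prod.dist_eq]
    rw [prod_singleton, hi.hausdorffMeasure_image (.inl zero_le_one), hausdorffMeasure_real]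
    exact measure_Icc_lt_top
  have hsub : frontier (region S) ⊆ ⋃ R ∈ S,
      (({R.x₀} ×ˢ Icc R.y₀ R.y₁ ∪ {R.x₁} ×ˢ Icc R.y₀ R.y₁) ∪
        (Icc R.x₀ R.x₁ ×ˢ {R.y₀} ∪ Icc R.x₀ R.x₁ ×ˢ {R.y₁})) := by
    intro z hz
    obtain ⟨R, hR, hzR⟩ := mem_region.1 (frontier_subset_region S hz)
    have hzi : z ∉ interior R.carrier := by
      rw [(isClosed_region S).frontier_eq] at hz
      exact fun h => hz.2 (interior_mono (carrier_subset_region hR) h)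
    rw [Rect.mem_interior] at hzi
    rw [Rect.mem_carrier] at hzR
    refine mem_biUnion hR ?_
    simp only [mem_union, mem_prod, mem_singleton_iff, mem_Icc]
    grind
  refine (measure_mono hsub).trans_lt ?_
  refine (measure_biUnion_finset_le S _).trans_lt (ENNReal.sum_lt_top.2 fun R _ => ?_)
  exact measure_union_lt_top (measure_union_lt_top (hv _ _ _) (hv _ _ _))
    (measure_union_lt_top (hh _ _ _) (hh _ _ _))

/-! ### Bilinear interpolation and the finite element spaces -/

/-- The bilinear function on the rectangle `R` that takes the values of `g` at the vertices. -/
def Rect.interp (R : Rect) (g : ℝ × ℝ → ℝ) (x : ℝ × ℝ) : ℝ :=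
  ((R.x₁ - x.1) * (R.y₁ - x.2)) / ((R.x₁ - R.x₀) * (R.y₁ - R.y₀)) * g (R.x₀, R.y₀) +
  ((x.1 - R.x₀) * (R.y₁ - x.2)) / ((R.x₁ - R.x₀) * (R.y₁ - R.y₀)) * g (R.x₁, R.y₀) +
  ((R.x₁ - x.1) * (x.2 - R.y₀)) / ((R.x₁ - R.x₀) * (R.y₁ - R.y₀)) * g (R.x₀, R.y₁) +
  ((x.1 - R.x₀) * (x.2 - R.y₀)) / ((R.x₁ - R.x₀) * (R.y₁ - R.y₀)) * g (R.x₁, R.y₁)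

/-- Only the two nodal values on the edge enter. This and its three analogues let interpolants of
neighbouring cells match and nodal values control traces. -/
theorem Rect.interp_left (R : Rect) (g : ℝ × ℝ → ℝ) (Y : ℝ) :
    R.interp g (R.x₀, Y) =
      (R.y₁ - Y) / (R.y₁ - R.y₀) * g (R.x₀, R.y₀) +
        (Y - R.y₀) / (R.y₁ - R.y₀) * g (R.x₀, R.y₁) := by
  have h1 := sub_ne_zero.2 R.hx.ne'
  have h2 := sub_ne_zero.2 R.hy.ne'
  simp only [Rect.interp]
  field_simp
  ring

theorem Rect.interp_right (R : Rect) (g : ℝ × ℝ → ℝ) (Y : ℝ) :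
    R.interp g (R.x₁, Y) =
      (R.y₁ - Y) / (R.y₁ - R.y₀) * g (R.x₁, R.y₀) +
        (Y - R.y₀) / (R.y₁ - R.y₀) * g (R.x₁, R.y₁) := by
  have h1 := sub_ne_zero.2 R.hx.ne'
  have h2 := sub_ne_zero.2 R.hy.ne'
  simp only [Rect.interp]
  field_simp
  ring

theorem Rect.interp_bottom (R : Rect) (g : ℝ × ℝ → ℝ) (X : ℝ) :
    R.interp g (X, R.y₀) =
      (R.x₁ - X) / (R.x₁ - R.x₀) * g (R.x₀, R.y₀) +
        (X - R.x₀) / (R.x₁ - R.x₀) * g (R.x₁, R.y₀) := by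
  have h1 := sub_ne_zero.2 R.hx.ne'
  have h2 := sub_ne_zero.2 R.hy.ne'
  simp only [Rect.interp]
  field_simp
  ring

theorem Rect.interp_top (R : Rect) (g : ℝ × ℝ → ℝ) (X : ℝ) :
    R.interp g (X, R.y₁) =
      (R.x₁ - X) / (R.x₁ - R.x₀) * g (R.x₀, R.y₁) +
        (X - R.x₀) / (R.x₁ - R.x₀) * g (R.x₁, R.y₁) := by
  have h1 := sub_ne_zero.2 R.hx.ne'
  have h2 := sub_ne_zero.2 R.hy.ne'
  simp only [Rect.interp]
  field_simp
  ring

theorem Rect.interp_corner (R : Rect) (g : ℝ × ℝ → ℝ) {z : ℝ × ℝ} (hz : z ∈ R.corners) :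
    R.interp g z = g z := by
  have h2 := sub_ne_zero.2 R.hy.ne'
  obtain ⟨X, Y⟩ := z
  obtain ⟨rfl | rfl, rfl | rfl⟩ := Rect.mem_corners.1 hz <;>
    simp [Rect.interp_left, Rect.interp_right, div_self h2]

theorem Rect.interp_congr (R : Rect) {g g' : ℝ × ℝ → ℝ} (h : EqOn g g' R.corners) :
    R.interp g = R.interp g' := by
  funext x
  simp only [Rect.interp]
  rw [h (x := (R.x₀, R.y₀)) (by simp [Rect.mem_corners]),
    h (x := (R.x₀, R.y₁)) (by simp [Rect.mem_corners]),
    h (x := (R.x₁, R.y₀)) (by simp [Rect.mem_corners]),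
    h (x := (R.x₁, R.y₁)) (by simp [Rect.mem_corners])]

theorem Rect.interp_bilinear (R : Rect) (g : ℝ × ℝ → ℝ) : ∃ α β δ ε : ℝ, ∀ x,
    R.interp g x = α + β * x.1 + δ * x.2 + ε * (x.1 * x.2) := by
  have h1 := sub_ne_zero.2 R.hx.ne'
  have h2 := sub_ne_zero.2 R.hy.ne'
  refine ⟨(R.x₁ * R.y₁ * g (R.x₀, R.y₀) - R.x₀ * R.y₁ * g (R.x₁, R.y₀) -
      R.x₁ * R.y₀ * g (R.x₀, R.y₁) + R.x₀ * R.y₀ * g (R.x₁, R.y₁)) /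
        ((R.x₁ - R.x₀) * (R.y₁ - R.y₀)),
    (-R.y₁ * g (R.x₀, R.y₀) + R.y₁ * g (R.x₁, R.y₀) +
      R.y₀ * g (R.x₀, R.y₁) - R.y₀ * g (R.x₁, R.y₁)) / ((R.x₁ - R.x₀) * (R.y₁ - R.y₀)),
    (-R.x₁ * g (R.x₀, R.y₀) + R.x₀ * g (R.x₁, R.y₀) +
      R.x₁ * g (R.x₀, R.y₁) - R.x₀ * g (R.x₁, R.y₁)) / ((R.x₁ - R.x₀) * (R.y₁ - R.y₀)),
    (g (R.x₀, R.y₀) - g (R.x₁, R.y₀) - g (R.x₀, R.y₁) + g (R.x₁, R.y₁)) /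
        ((R.x₁ - R.x₀) * (R.y₁ - R.y₀)), fun x => ?_⟩
  simp only [Rect.interp]
  field_simp
  ring

theorem Rect.eqOn_interp (R : Rect) {u : ℝ × ℝ → ℝ}
    (h : ∃ α β δ ε : ℝ, ∀ x ∈ R.carrier, u x = α + β * x.1 + δ * x.2 + ε * (x.1 * x.2)) :
    EqOn u (R.interp u) R.carrier := by
  obtain ⟨α, β, δ, ε, h⟩ := h
  have h1 := sub_ne_zero.2 R.hx.ne'
  have h2 := sub_ne_zero.2 R.hy.ne'
  intro x hx
  have hc := fun z hz => h z (R.corners_subset hz)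
  simp only [Rect.interp]
  rw [h x hx, hc (R.x₀, R.y₀) (by simp [Rect.mem_corners]),
    hc (R.x₀, R.y₁) (by simp [Rect.mem_corners]), hc (R.x₁, R.y₀) (by simp [Rect.mem_corners]),
    hc (R.x₁, R.y₁) (by simp [Rect.mem_corners])]
  field_simp
  ring

/-- The bilinear interpolants on two cells agree on the intersection of the cells. -/
theorem FineMesh.interp_eq_interp {R R' : Rect} (hR : R ∈ M.cells) (hR' : R' ∈ M.cells)
    (g : ℝ × ℝ → ℝ) {z : ℝ × ℝ} (hz : z ∈ R.carrier) (hz' : z ∈ R'.carrier) :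
    R.interp g z = R'.interp g z := by
  by_cases hne : R = R'
  · rw [hne]
  by_cases hc : z ∈ R.corners
  · rw [R.interp_corner g hc, R'.interp_corner g (M.no_hanging_nodes R' hR' R hR ⟨hc, hz'⟩)]
  obtain ⟨X, Y⟩ := z
  rcases M.shared_edge hR hR' hne hz hz' hc with ⟨⟨e, e'⟩ | ⟨e, e'⟩, f, f', -, -⟩ |
      ⟨⟨e, e'⟩ | ⟨e, e'⟩, f, f', -, -⟩ <;> simp only at e <;> subst e
  · rw [Rect.interp_left, e', f, f', Rect.interp_right]
  · rw [Rect.interp_right, e', f, f', Rect.interp_left]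
  · rw [Rect.interp_bottom, e', f, f', Rect.interp_top]
  · rw [Rect.interp_top, e', f, f', Rect.interp_bottom]

/-- Continuity is automatic: `u` is continuous on each of finitely many closed cells that cover the
region. -/
theorem mem_femSpace_of_eqOn_interp {S : Finset Rect} {u : ℝ × ℝ → ℝ}
    (h : ∀ R ∈ S, EqOn u (R.interp u) R.carrier) (h0 : ∀ x, x ∉ region S → u x = 0) :
    u ∈ femSpace S := by
  refine ⟨?_, fun R hR => ?_, h0⟩
  · have : region S = ⋃ R : S, R.1.carrier := by
      ext x; simp [mem_region]
    rw [this]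
    refine (locallyFinite_of_finite _).continuousOn_iUnion (fun R => R.1.isClosed_carrier)
      fun R => ?_
    refine ContinuousOn.congr (Continuous.continuousOn ?_) (h R.1 R.2)
    unfold Rect.interp
    fun_prop
  · obtain ⟨α, β, δ, ε, e⟩ := R.interp_bilinear u
    exact ⟨α, β, δ, ε, fun x hx => (h R hR hx).trans (e x)⟩

theorem eqOn_interp_of_mem {S : Finset Rect} {u : ℝ × ℝ → ℝ} (hu : u ∈ femSpace S) {R : Rect}
    (hR : R ∈ S) : EqOn u (R.interp u) R.carrier :=
  R.eqOn_interp (hu.2.1 R hR)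

/-- There is a finite element function with prescribed nodal values. -/
theorem FineMesh.exists_mem_femSpace {S : Finset Rect} (hS : S ⊆ M.cells) (g : ℝ × ℝ → ℝ) :
    ∃ u ∈ femSpace S, EqOn u g (nodes S) := by
  classical
  -- The chosen cell is immaterial, since interpolants agree on common points of cells.
  let u : ℝ × ℝ → ℝ := fun x => if hx : x ∈ region S then
    (Classical.choose (mem_region.1 hx)).interp g x else 0
  have hu : ∀ R ∈ S, EqOn u (R.interp g) R.carrier := by
    intro R hR x hx
    have hxS := carrier_subset_region hR hx
    have hs := Classical.choose_spec (mem_region.1 hxS)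
    simp only [u, dif_pos hxS]
    exact M.interp_eq_interp (hS hs.1) (hS hR) g hs.2 hx
  have hc : ∀ R ∈ S, EqOn u g R.corners := fun R hR x hx =>
    (hu R hR (R.corners_subset hx)).trans (R.interp_corner g hx)
  refine ⟨u, mem_femSpace_of_eqOn_interp (fun R hR => ?_) fun x hx => dif_neg hx, fun x hx => ?_⟩
  · rw [R.interp_congr (hc R hR)]
    exact hu R hR
  · obtain ⟨R, hR, hxR⟩ := mem_nodes.1 hx
    exact hc R hR hxR

/-- A finite element function that vanishes at the boundary nodes vanishes on the boundary. -/
theorem FineMesh.eq_zero_of_bdryNodes {S : Finset Rect} (hS : S ⊆ M.cells) {u : ℝ × ℝ → ℝ}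
    (hu : u ∈ femSpace S) (h : ∀ x ∈ bdryNodes S, u x = 0) {z : ℝ × ℝ}
    (hz : z ∈ frontier (region S)) : u z = 0 := by
  obtain ⟨R, hR, hzR⟩ := mem_region.1 (frontier_subset_region S hz)
  by_cases hc : z ∈ R.corners
  · exact h z ⟨hz, R, hR, hc⟩
  rw [eqOn_interp_of_mem hu hR hzR]
  obtain ⟨X, Y⟩ := z
  rcases M.exists_boundary_edge hS hR hz hzR hc with ⟨e | e, h1, h2⟩ | ⟨e | e, h1, h2⟩ <;>
    simp only at e h1 h2 <;> subst e
  · rw [Rect.interp_left, h _ h1, h _ h2]; simp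
  · rw [Rect.interp_right, h _ h1, h _ h2]; simp
  · rw [Rect.interp_bottom, h _ h1, h _ h2]; simp
  · rw [Rect.interp_top, h _ h1, h _ h2]; simp

theorem indicator_mem_femSpace {S S' : Finset Rect} (hS : S ⊆ S') {u : ℝ × ℝ → ℝ}
    (hu : u ∈ femSpace S') : (region S).indicator u ∈ femSpace S := by
  have he : EqOn ((region S).indicator u) u (region S) := eqOn_indicator
  refine ⟨(hu.1.mono (region_mono hS)).congr he, fun R hR => ?_,
    fun x hx => indicator_of_notMem hx u⟩
  obtain ⟨α, β, δ, ε, e⟩ := hu.2.1 R (hS hR)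
  exact ⟨α, β, δ, ε, fun x hx => (he (carrier_subset_region hR hx)).trans (e x hx)⟩

/-- The function is continuous on the closed region and zero on the closure of the complement; these
two closed sets cover the plane. -/
theorem continuous_of_mem_femSpaceZero {S : Finset Rect} {v : ℝ × ℝ → ℝ}
    (hv : v ∈ femSpaceZero S) : Continuous v := by
  have h1 : ContinuousOn v (closure (region S)ᶜ) := by
    refine continuousOn_const.congr (f := fun _ => (0 : ℝ)) fun x hx => ?_
    by_cases hxS : x ∈ region S
    · exact hv.2 x (by
        rw [(isClosed_region S).frontier_eq]
        rw [closure_compl] at hx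
        exact ⟨hxS, hx⟩)
    · exact hv.1.2.2 x hxS
  have h2 := hv.1.1.union_of_isClosed h1 (isClosed_region S) isClosed_closure
  rw [← continuousOn_univ]
  refine h2.mono fun x _ => ?_
  by_cases hx : x ∈ region S
  · exact .inl hx
  · exact .inr (subset_closure hx)

/-- Extension by zero maps the local spaces with zero boundary values into the global one. -/
theorem FineMesh.femSpaceZero_le {S : Finset Rect} (hS : S ⊆ M.cells) :
    femSpaceZero S ≤ femSpaceZero M.cells := by
  intro v hv
  have h0 : ∀ R ∈ M.cells, R ∉ S → ∀ x ∈ R.carrier, v x = 0 := by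
    intro R hR hRS x hx
    by_cases hxS : x ∈ region S
    · exact hv.2 x (M.mem_frontier_of_mem_other hS hR hRS hxS hx)
    · exact hv.1.2.2 x hxS
  refine ⟨⟨(continuous_of_mem_femSpaceZero hv).continuousOn, fun R hR => ?_, fun x hx => ?_⟩,
    fun x hx => ?_⟩
  · by_cases hRS : R ∈ S
    · exact hv.1.2.1 R hRS
    · exact ⟨0, 0, 0, 0, fun x hx => by simp [h0 R hR hRS x hx]⟩
  · exact hv.1.2.2 x fun h => hx (region_mono hS h)
  · by_cases hxS : x ∈ region S
    · refine hv.2 x ?_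
      rw [(isClosed_region _).frontier_eq] at hx ⊢
      exact ⟨hxS, fun h => hx.2 (interior_mono (region_mono hS) h)⟩
    · exact hv.1.2.2 x hxS

/-- The pointwise time derivative of a curve of finite element functions is a finite element
function. -/
theorem mem_femSpace_of_hasDerivWithinAt {S : Finset Rect} {T : ℝ} (hT : 0 < T)
    {u u' : ℝ → ℝ × ℝ → ℝ} (hu : ∀ t ∈ Icc 0 T, u t ∈ femSpace S)
    (h : ∀ t ∈ Icc 0 T, ∀ x, HasDerivWithinAt (fun s => u s x) (u' t x) (Icc 0 T) t) {t : ℝ}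
    (ht : t ∈ Icc 0 T) : u' t ∈ femSpace S := by
  have hU : UniqueDiffWithinAt ℝ (Icc 0 T) t := uniqueDiffOn_Icc hT t ht
  refine mem_femSpace_of_eqOn_interp (fun R hR x hx => ?_) fun x hx => ?_
  · have h1 : HasDerivWithinAt (fun s => R.interp (u s) x) (R.interp (u' t) x) (Icc 0 T) t := by
      unfold Rect.interp
      exact ((((h t ht _).const_mul _).add ((h t ht _).const_mul _)).add
        ((h t ht _).const_mul _)).add ((h t ht _).const_mul _)
    have h2 : HasDerivWithinAt (fun s => u s x) (R.interp (u' t) x) (Icc 0 T) t :=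
      h1.congr (fun s hs => eqOn_interp_of_mem (hu s hs) hR hx) (eqOn_interp_of_mem (hu t ht) hR hx)
    exact hU.eq_deriv _ (h t ht x) h2
  · have h2 : HasDerivWithinAt (fun s => u s x) 0 (Icc 0 T) t :=
      (hasDerivWithinAt_const t (Icc 0 T) (0 : ℝ)).congr (fun s hs => (hu s hs).2.2 x hx)
        ((hu t ht).2.2 x hx)
    exact hU.eq_deriv _ (h t ht x) h2

/-! ### Square integrable functions -/

theorem integrable_mul_of_memLp_two {X : Type*} [MeasurableSpace X] {ν : Measure X} {u v : X → ℝ}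
    (hu : MemLp u 2 ν) (hv : MemLp v 2 ν) : Integrable (fun x => u x * v x) ν :=
  hu.integrable_mul hv

theorem integral_sum_smul_mul {X ι : Type*} [MeasurableSpace X] {ν : Measure X} (s : Finset ι)
    {e : ι → X → ℝ} (he : ∀ i, MemLp (e i) 2 ν) {v : X → ℝ} (hv : MemLp v 2 ν) (c : ι → ℝ) :
    ∫ x, (∑ i ∈ s, c i • e i) x * v x ∂ν = ∑ i ∈ s, c i * ∫ x, e i x * v x ∂ν := by
  simp only [Finset.sum_apply, Pi.smul_apply, smul_eq_mul, Finset.sum_mul, mul_assoc]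
  rw [integral_finsetSum _ fun i _ => (integrable_mul_of_memLp_two (he i) hv).const_mul (c i)]
  simp only [integral_const_mul]

/-- Bessel's inequality for a finite orthonormal family of square integrable functions. -/
theorem sum_sq_integral_mul_le {X : Type*} [MeasurableSpace X] {ν : Measure X} {n : ℕ}
    {e : Fin n → X → ℝ} (he : ∀ i, MemLp (e i) 2 ν)
    (ho : ∀ i j, ∫ x, e i x * e j x ∂ν = if i = j then 1 else 0)
    {g : X → ℝ} (hg : MemLp g 2 ν) :
    ∑ i, (∫ x, g x * e i x ∂ν) ^ 2 ≤ ∫ x, g x ^ 2 ∂ν := by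
  set G : Fin n → ℝ := fun i => ∫ x, g x * e i x ∂ν with hG
  set s : X → ℝ := ∑ i, G i • e i with hs
  have hsm : MemLp s 2 ν := memLp_finsetSum' _ fun i _ => (he i).const_smul (G i)
  have h1 : ∫ x, s x * g x ∂ν = ∑ i, G i ^ 2 := by
    rw [hs, integral_sum_smul_mul _ he hg]
    refine Finset.sum_congr rfl fun i _ => ?_
    rw [sq]
    simp only [hG, mul_comm]
  have h2 : ∫ x, s x * s x ∂ν = ∑ i, G i ^ 2 := by
    conv_lhs => rw [hs]
    rw [integral_sum_smul_mul _ he hsm]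
    refine Finset.sum_congr rfl fun i _ => ?_
    have : ∫ x, e i x * s x ∂ν = G i := by
      simp_rw [mul_comm (e i _)]
      rw [hs, integral_sum_smul_mul _ he (he i)]
      simp [ho]
    rw [this, sq]
  -- Here `s` is the orthogonal projection of `g` onto the span of the family.
  have h3 : 0 ≤ ∫ x, (g x - s x) ^ 2 ∂ν := integral_nonneg fun x => sq_nonneg _
  have h4 : ∫ x, (g x - s x) ^ 2 ∂ν
      = ∫ x, g x ^ 2 ∂ν - 2 * ∫ x, s x * g x ∂ν + ∫ x, s x * s x ∂ν := by
    have i1 : Integrable (fun x => 2 * (s x * g x)) ν :=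
      (integrable_mul_of_memLp_two hsm hg).const_mul 2
    have i2 : Integrable (fun x => g x ^ 2 - 2 * (s x * g x)) ν := hg.integrable_sq.sub i1
    rw [← integral_const_mul, ← integral_sub hg.integrable_sq i1, ← integral_add
      i2 (integrable_mul_of_memLp_two hsm hsm)]
    refine integral_congr_ae (.of_forall fun x => ?_)
    ring
  rw [h4, h1, h2] at h3
  linarith

theorem memLp_two_of_continuousOn {X : Type*} [TopologicalSpace X] [T2Space X]
    [MeasurableSpace X] [OpensMeasurableSpace X] {ν : Measure X} {K : Set X} (hK : IsCompact K)
    (hν : ν K < ⊤) {u : X → ℝ} (hu : ContinuousOn u K) :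
    MemLp u 2 (ν.restrict K) := by
  have : IsFiniteMeasure (ν.restrict K) := ⟨by rwa [Measure.restrict_apply_univ]⟩
  obtain ⟨C, hC⟩ := hK.exists_bound_of_continuousOn hu
  exact MemLp.of_bound (hu.aestronglyMeasurable_of_isCompact hK hK.measurableSet) C
    (ae_restrict_of_forall_mem hK.measurableSet hC)

theorem memLp_region_of_mem {S : Finset Rect} {u : ℝ × ℝ → ℝ} (hu : u ∈ femSpace S) :
    MemLp u 2 (volume.restrict (region S)) :=
  memLp_two_of_continuousOn (isCompact_region S) (isCompact_region S).measure_lt_top hu.1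

theorem isCompact_frontier_region (S : Finset Rect) : IsCompact (frontier (region S)) :=
  (isCompact_region S).of_isClosed_subset isClosed_frontier (frontier_subset_region S)

theorem memLp_frontier_of_mem {S : Finset Rect} {u : ℝ × ℝ → ℝ} (hu : u ∈ femSpace S) :
    MemLp u 2 ((Measure.hausdorffMeasure 1).restrict (frontier (region S))) :=
  memLp_two_of_continuousOn (isCompact_frontier_region S)
    (hausdorffMeasure_frontier_region_lt_top S) (hu.1.mono (frontier_subset_region S))

/-! ### The energy form -/

/-- Cells are convex, so their frontiers are null. Energy identities can therefore be checked inside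
open cells, where finite element functions are polynomials. -/
theorem ae_mem_interior (S : Finset Rect) :
    ∀ᵐ x ∂volume.restrict (region S), ∃ R ∈ S, x ∈ interior R.carrier := by
  rw [ae_restrict_iff' (measurableSet_region S)]
  have h : ∀ᵐ x : ℝ × ℝ, ∀ R ∈ S, x ∉ frontier R.carrier := by
    rw [S.eventually_all]
    intro R _
    have hc : Convex ℝ R.carrier := (convex_Icc _ _).prod (convex_Icc _ _)
    exact compl_mem_ae_iff.2 (hc.addHaar_frontier volume)
  filter_upwards [h] with x hx hxS
  obtain ⟨R, hR, hxR⟩ := mem_region.1 hxS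
  refine ⟨R, hR, ?_⟩
  by_contra hi
  exact hx R hR (by rw [R.isClosed_carrier.frontier_eq]; exact ⟨hxR, hi⟩)

/-- The form of a finite element function and of its gradient in the interior of a cell. -/
theorem exists_gradient {S : Finset Rect} {u : ℝ × ℝ → ℝ} (hu : u ∈ femSpace S) {R : Rect}
    (hR : R ∈ S) : ∃ α β δ ε : ℝ,
      (∀ x ∈ R.carrier, u x = α + β * x.1 + δ * x.2 + ε * (x.1 * x.2)) ∧
      ∀ x ∈ interior R.carrier, DifferentiableAt ℝ u x ∧
        fderiv ℝ u x (1, 0) = β + ε * x.2 ∧ fderiv ℝ u x (0, 1) = δ + ε * x.1 := by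
  obtain ⟨α, β, δ, ε, h⟩ := hu.2.1 R hR
  refine ⟨α, β, δ, ε, h, fun x hx => ?_⟩
  have he : u =ᶠ[nhds x] fun x => α + β * x.1 + δ * x.2 + ε * (x.1 * x.2) := by
    filter_upwards [isOpen_interior.mem_nhds hx] with y hy using h y (interior_subset hy)
  have h1 : HasFDerivAt (fun x : ℝ × ℝ => x.1) (ContinuousLinearMap.fst ℝ ℝ ℝ) x := hasFDerivAt_fst
  have h2 : HasFDerivAt (fun x : ℝ × ℝ => x.2) (ContinuousLinearMap.snd ℝ ℝ ℝ) x := hasFDerivAt_snd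
  have hd := (((h1.const_mul β).const_add α).add (h2.const_mul δ)).add ((h1.mul h2).const_mul ε)
  have hd' := hd.congr_of_eventuallyEq he
  refine ⟨hd'.differentiableAt, ?_, ?_⟩ <;> rw [hd'.fderiv] <;> simp

theorem differentiableAt_of_mem {S : Finset Rect} {u : ℝ × ℝ → ℝ} (hu : u ∈ femSpace S) {R : Rect}
    (hR : R ∈ S) {x : ℝ × ℝ} (hx : x ∈ interior R.carrier) : DifferentiableAt ℝ u x := by
  obtain ⟨_, _, _, _, _, h⟩ := exists_gradient hu hR
  exact (h x hx).1

theorem integrableOn_energy {S : Finset Rect} {a : ℝ × ℝ → ℝ} (ha : Measurable a) {a₁ : ℝ}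
    (hb : ∀ x ∈ region S, |a x| ≤ a₁) {u v : ℝ × ℝ → ℝ} (hu : u ∈ femSpace S)
    (hv : v ∈ femSpace S) :
    IntegrableOn (fun x => a x * (fderiv ℝ u x (1, 0) * fderiv ℝ v x (1, 0) +
      fderiv ℝ u x (0, 1) * fderiv ℝ v x (0, 1))) (region S) := by
  rw [region, integrableOn_finset_iUnion]
  intro R hR
  obtain ⟨α, β, δ, ε, -, h⟩ := exists_gradient hu hR
  obtain ⟨α', β', δ', ε', -, h'⟩ := exists_gradient hv hR
  have hcont : Continuous fun x : ℝ × ℝ => (β + ε * x.2) * (β' + ε' * x.2) +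
      (δ + ε * x.1) * (δ' + ε' * x.1) := by fun_prop
  have hi := hcont.continuousOn.integrableOn_compact (μ := volume) R.isCompact_carrier
  have hi' := Integrable.bdd_mul (f := a) hi ha.aestronglyMeasurable (c := a₁)
    (ae_restrict_of_forall_mem R.isClosed_carrier.measurableSet
      fun x hx => hb x (carrier_subset_region hR hx))
  refine hi'.congr ?_
  have hae : ∀ᵐ x ∂volume.restrict R.carrier, x ∈ interior R.carrier := by
    have := ae_mem_interior {R}
    simpa [region] using this
  filter_upwards [hae] with x hx
  rw [(h x hx).2.1, (h x hx).2.2, (h' x hx).2.1, (h' x hx).2.2]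

theorem energy_comm (a : ℝ × ℝ → ℝ) (S : Finset Rect) (u v : ℝ × ℝ → ℝ) :
    energy a S u v = energy a S v u := by
  simp only [energy, mul_comm]

theorem energy_congr_left {a : ℝ × ℝ → ℝ} {S : Finset Rect} {u u' : ℝ × ℝ → ℝ}
    (h : EqOn u u' (region S)) (v : ℝ × ℝ → ℝ) : energy a S u v = energy a S u' v := by
  refine integral_congr_ae ?_
  filter_upwards [ae_mem_interior S] with x hx
  obtain ⟨R, hR, hxR⟩ := hx
  have he : u =ᶠ[nhds x] u' := by
    filter_upwards [isOpen_interior.mem_nhds hxR] with y hy using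
      h (carrier_subset_region hR (interior_subset hy))
  rw [he.fderiv_eq]

theorem energy_congr {a : ℝ × ℝ → ℝ} {S : Finset Rect} {u u' v v' : ℝ × ℝ → ℝ}
    (h : EqOn u u' (region S)) (h' : EqOn v v' (region S)) :
    energy a S u v = energy a S u' v' := by
  rw [energy_congr_left h, energy_comm, energy_congr_left h', energy_comm]

theorem energy_add_left {S : Finset Rect} {a : ℝ × ℝ → ℝ} (ha : Measurable a) {a₁ : ℝ}
    (hb : ∀ x ∈ region S, |a x| ≤ a₁) {u u' v : ℝ × ℝ → ℝ} (hu : u ∈ femSpace S)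
    (hu' : u' ∈ femSpace S) (hv : v ∈ femSpace S) :
    energy a S (u + u') v = energy a S u v + energy a S u' v := by
  unfold energy
  rw [← integral_add (integrableOn_energy ha hb hu hv) (integrableOn_energy ha hb hu' hv)]
  refine integral_congr_ae ?_
  filter_upwards [ae_mem_interior S] with x hx
  obtain ⟨R, hR, hxR⟩ := hx
  rw [fderiv_add (differentiableAt_of_mem hu hR hxR) (differentiableAt_of_mem hu' hR hxR)]
  simp only [add_apply]
  ring

theorem energy_smul_left {S : Finset Rect} {a : ℝ × ℝ → ℝ} (c : ℝ) {u : ℝ × ℝ → ℝ}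
    (hu : u ∈ femSpace S) (v : ℝ × ℝ → ℝ) :
    energy a S (c • u) v = c * energy a S u v := by
  unfold energy
  rw [← integral_const_mul]
  refine integral_congr_ae ?_
  filter_upwards [ae_mem_interior S] with x hx
  obtain ⟨R, hR, hxR⟩ := hx
  rw [fderiv_const_smul (differentiableAt_of_mem hu hR hxR)]
  simp only [smul_apply, smul_eq_mul]
  ring

theorem energy_sum_left {S : Finset Rect} {a : ℝ × ℝ → ℝ} (ha : Measurable a) {a₁ : ℝ}
    (hb : ∀ x ∈ region S, |a x| ≤ a₁) {ι : Type*} (s : Finset ι) (c : ι → ℝ) {e : ι → ℝ × ℝ → ℝ}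
    (he : ∀ i, e i ∈ femSpace S) {v : ℝ × ℝ → ℝ} (hv : v ∈ femSpace S) :
    energy a S (∑ i ∈ s, c i • e i) v = ∑ i ∈ s, c i * energy a S (e i) v := by
  classical
  induction s using Finset.induction_on with
  | empty =>
    rw [Finset.sum_empty, Finset.sum_empty, ← zero_smul ℝ (0 : ℝ × ℝ → ℝ),
      energy_smul_left 0 (zero_mem _), zero_mul]
  | insert i s hi ih =>
    rw [Finset.sum_insert hi, Finset.sum_insert hi, energy_add_left ha hb
      (Submodule.smul_mem _ _ (he i)) (Submodule.sum_mem _ fun j _ => Submodule.smul_mem _ _ (he j))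
      hv, ih, energy_smul_left _ (he i)]

theorem energy_self_nonneg {S : Finset Rect} {a : ℝ × ℝ → ℝ} (h0 : ∀ x ∈ region S, 0 ≤ a x)
    (u : ℝ × ℝ → ℝ) : 0 ≤ energy a S u u :=
  setIntegral_nonneg (measurableSet_region S) fun x hx =>
    mul_nonneg (h0 x hx) (add_nonneg (mul_self_nonneg _) (mul_self_nonneg _))

/-- A finite element function of zero energy is constant on every cell. -/
theorem constant_on_cell_of_energy_eq_zero {S : Finset Rect} {a : ℝ × ℝ → ℝ} (ha : Measurable a)
    {a₁ : ℝ} (hb : ∀ x ∈ region S, 0 < a x ∧ a x ≤ a₁) {u : ℝ × ℝ → ℝ} (hu : u ∈ femSpace S)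
    (h : energy a S u u = 0) {R : Rect} (hR : R ∈ S) : ∃ C, ∀ x ∈ R.carrier, u x = C := by
  have hb' : ∀ x ∈ region S, |a x| ≤ a₁ := fun x hx => by
    rw [abs_of_pos (hb x hx).1]; exact (hb x hx).2
  have hae := (setIntegral_eq_zero_iff_of_nonneg_ae
    (ae_restrict_of_forall_mem (measurableSet_region S) fun x hx =>
      mul_nonneg (hb x hx).1.le (add_nonneg (mul_self_nonneg _) (mul_self_nonneg _)))
    (integrableOn_energy ha hb' hu hu)).1 h
  have hsub : interior R.carrier ⊆ region S := interior_subset.trans (carrier_subset_region hR)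
  have hae' := ae_restrict_of_ae_restrict_of_subset hsub hae
  obtain ⟨α, β, δ, ε, hf, hg⟩ := exists_gradient hu hR
  have key : ∀ᵐ x ∂volume.restrict (interior R.carrier), β + ε * x.2 = 0 ∧ δ + ε * x.1 = 0 := by
    rw [ae_restrict_iff' isOpen_interior.measurableSet] at hae' ⊢
    filter_upwards [hae'] with x hx hxR
    have h1 := hx hxR
    obtain ⟨-, h2, h3⟩ := hg x hxR
    rw [h2, h3] at h1
    have h4 := (mul_eq_zero.1 h1).resolve_left (hb x (hsub hxR)).1.ne'
    constructor <;> nlinarith [mul_self_nonneg (β + ε * x.2), mul_self_nonneg (δ + ε * x.1)]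
  have k1 : EqOn (fun x : ℝ × ℝ => β + ε * x.2) (fun _ => 0) (interior R.carrier) :=
    Measure.eqOn_open_of_ae_eq (key.mono fun x hx => hx.1) isOpen_interior
      (by fun_prop) (by fun_prop)
  have k2 : EqOn (fun x : ℝ × ℝ => δ + ε * x.1) (fun _ => 0) (interior R.carrier) :=
    Measure.eqOn_open_of_ae_eq (key.mono fun x hx => hx.2) isOpen_interior
      (by fun_prop) (by fun_prop)
  -- Comparing `β + ε * x.2 = 0` at two heights `Y < Z` gives `ε = 0`; then `β` and `δ` vanish as
  -- well.
  obtain ⟨X, hX, hX'⟩ := exists_between R.hx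
  obtain ⟨Y, hY, hY'⟩ := exists_between R.hy
  obtain ⟨Z, hZ, hZ'⟩ := exists_between hY'
  have e1 := k1 (Rect.mem_interior.2 ⟨⟨hX, hX'⟩, hY, hY'⟩ : (X, Y) ∈ _)
  have e2 := k1 (Rect.mem_interior.2 ⟨⟨hX, hX'⟩, hY.trans hZ, hZ'⟩ : (X, Z) ∈ _)
  have e3 := k2 (Rect.mem_interior.2 ⟨⟨hX, hX'⟩, hY, hY'⟩ : (X, Y) ∈ _)
  simp only at e1 e2 e3
  have e4 : ε = 0 := by
    have : ε * (Z - Y) = 0 := by linarith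
    exact (mul_eq_zero.1 this).resolve_right (sub_ne_zero.2 hZ.ne')
  subst e4
  refine ⟨α, fun x hx => ?_⟩
  have e5 : β = 0 := by linarith
  have e6 : δ = 0 := by linarith
  rw [hf x hx, e5, e6]
  ring

/-- A finite element function of zero energy on a connected region is constant. -/
theorem constant_of_energy_eq_zero {S : Finset Rect} (hS : IsConnected (region S))
    {a : ℝ × ℝ → ℝ} (ha : Measurable a) {a₁ : ℝ} (hb : ∀ x ∈ region S, 0 < a x ∧ a x ≤ a₁)
    {u : ℝ × ℝ → ℝ} (hu : u ∈ femSpace S) (h : energy a S u u = 0) :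
    ∃ C, ∀ x ∈ region S, u x = C := by
  -- One constant per cell gives finitely many values, and a continuous function with finitely many
  -- values on a connected set is constant.
  have hfin : (u '' region S).Finite := by
    rw [region, image_iUnion₂]
    refine S.finite_toSet.biUnion fun R hR => ?_
    obtain ⟨C, hC⟩ := constant_on_cell_of_energy_eq_zero ha hb hu h hR
    refine (finite_singleton C).subset ?_
    rintro _ ⟨x, hx, rfl⟩
    exact hC x hx
  obtain ⟨x₀, hx₀⟩ := hS.nonempty
  exact ⟨u x₀, fun x hx =>
    hS.isPreconnected.constant_of_mapsTo hfin.isDiscrete hu.1 (mapsTo_image u _) hx hx₀⟩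

/-- The constant is zero because a nonempty compact region has a nonempty frontier. -/
theorem eq_zero_of_energy_eq_zero {S : Finset Rect} (hS : IsConnected (region S))
    {a : ℝ × ℝ → ℝ} (ha : Measurable a) {a₁ : ℝ} (hb : ∀ x ∈ region S, 0 < a x ∧ a x ≤ a₁)
    {u : ℝ × ℝ → ℝ} (hu : u ∈ femSpaceZero S) (h : energy a S u u = 0) : u = 0 := by
  obtain ⟨C, hC⟩ := constant_of_energy_eq_zero hS ha hb hu.1 h
  obtain ⟨y, hy⟩ := frontier_region_nonempty hS.nonempty
  have h0 : C = 0 := (hC y (frontier_subset_region S hy)).symm.trans (hu.2 y hy)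
  funext x
  by_cases hx : x ∈ region S
  · rw [hC x hx, h0, Pi.zero_apply]
  · exact hu.1.2.2 x hx

/-- Testing with a function supported in a part of the mesh. -/
theorem energy_eq_of_support {S S' : Finset Rect} (hS : S ⊆ S') (a u : ℝ × ℝ → ℝ)
    {v : ℝ × ℝ → ℝ} (hv : ∀ x, x ∉ region S → v x = 0) :
    energy a S' u v = energy a S u v := by
  refine setIntegral_eq_of_subset_of_forall_sdiff_eq_zero (measurableSet_region S')
    (region_mono hS) fun x hx => ?_
  have he : v =ᶠ[nhds x] fun _ => 0 := by
    filter_upwards [(isClosed_region S).isOpen_compl.mem_nhds hx.2] with y hy using hv y hy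
  rw [he.fderiv_eq]
  simp

/-! ### Local modes on a coarse block -/

/-- A connected union of fine cells together with a positive, bounded, measurable coefficient. -/
structure IsAdmissible (M : FineMesh) (a : ℝ × ℝ → ℝ) (a₁ : ℝ) (S : Finset Rect) : Prop where
  subset : S ⊆ M.cells
  connected : IsConnected (region S)
  measurable : Measurable a
  bounds : ∀ x ∈ region S, 0 < a x ∧ a x ≤ a₁

theorem IsAdmissible.abs_le {a : ℝ × ℝ → ℝ} {a₁ : ℝ} {S : Finset Rect}
    (hA : IsAdmissible M a a₁ S) : ∀ x ∈ region S, |a x| ≤ a₁ := fun x hx => by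
  rw [abs_of_pos (hA.bounds x hx).1]
  exact (hA.bounds x hx).2

variable {a : ℝ × ℝ → ℝ} {a₁ H : ℝ} {S : Finset Rect} {n n₀ : ℕ}
  {μ : Fin n → ℝ} {w : Fin n → ℝ × ℝ → ℝ} {ev : Fin n₀ → ℝ} {z : Fin n₀ → ℝ × ℝ → ℝ}

theorem snapshotSpace_le (a : ℝ × ℝ → ℝ) (S : Finset Rect) : snapshotSpace a S ≤ femSpace S :=
  Submodule.span_le.2 fun _ ⟨_, _, h⟩ => h.mem

/-- Energy orthogonality of boundary and interior modes: harmonicity of the generators passes to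
their span. -/
theorem IsAdmissible.energy_snapshotSpace (hA : IsAdmissible M a a₁ S) {u v : ℝ × ℝ → ℝ}
    (hu : u ∈ snapshotSpace a S) (hv : v ∈ femSpaceZero S) : energy a S u v = 0 := by
  have : u ∈ femSpace S ∧ energy a S u v = 0 := by
    induction hu using Submodule.span_induction with
    | mem x hx =>
      obtain ⟨_, _, h⟩ := hx
      exact ⟨h.mem, h.harmonic v hv⟩
    | zero =>
      refine ⟨zero_mem _, ?_⟩
      rw [← zero_smul ℝ (0 : ℝ × ℝ → ℝ), energy_smul_left 0 (zero_mem _), zero_mul]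
    | add x y _ _ hx hy =>
      exact ⟨add_mem hx.1 hy.1, by
        rw [energy_add_left hA.measurable hA.abs_le hx.1 hy.1 hv.1, hx.2, hy.2, add_zero]⟩
    | smul c x _ hx =>
      exact ⟨Submodule.smul_mem _ c hx.1, by rw [energy_smul_left c hx.1, hx.2, mul_zero]⟩
  exact this.2

theorem IsBoundaryEigensystem.mem (hw : IsBoundaryEigensystem a H S μ w) (i : Fin n) :
    w i ∈ snapshotSpace a S := hw.span_eq ▸ Submodule.subset_span (mem_range_self i)

theorem IsBoundaryEigensystem.mem_femSpace (hw : IsBoundaryEigensystem a H S μ w) (i : Fin n) :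
    w i ∈ femSpace S := snapshotSpace_le a S (hw.mem i)

theorem IsInteriorEigensystem.mem (hz : IsInteriorEigensystem a H S ev z) (i : Fin n₀) :
    z i ∈ femSpaceZero S := hz.span_eq ▸ Submodule.subset_span (mem_range_self i)

theorem IsInteriorEigensystem.mem_femSpace (hz : IsInteriorEigensystem a H S ev z) (i : Fin n₀) :
    z i ∈ femSpace S := (hz.mem i).1

theorem IsBoundaryEigensystem.energy_eq (hw : IsBoundaryEigensystem a H S μ w) (i j : Fin n) :
    energy a S (w i) (w j) = if i = j then μ i / H else 0 := by
  rw [hw.eigen i _ (hw.mem j), hw.orthonormal]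
  split_ifs <;> simp

theorem IsInteriorEigensystem.energy_eq (hz : IsInteriorEigensystem a H S ev z) (i j : Fin n₀) :
    energy a S (z i) (z j) = if i = j then ev i / H ^ 2 else 0 := by
  rw [hz.eigen i _ (hz.mem j), hz.orthonormal]
  split_ifs <;> simp

/-- A mode of zero energy would vanish, contradicting its unit norm. -/
theorem IsInteriorEigensystem.pos (hz : IsInteriorEigensystem a H S ev z)
    (hA : IsAdmissible M a a₁ S) (hH : 0 < H) (i : Fin n₀) : 0 < ev i := by
  have h1 := hz.energy_eq i i
  rw [if_pos rfl] at h1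
  have h2 : 0 ≤ energy a S (z i) (z i) := energy_self_nonneg (fun x hx => (hA.bounds x hx).1.le) _
  have h3 : energy a S (z i) (z i) ≠ 0 := by
    intro h
    have h0 := eq_zero_of_energy_eq_zero hA.connected hA.measurable hA.bounds (hz.mem i) h
    have := hz.orthonormal i i
    simp [h0] at this
  rw [h1] at h2 h3
  have h4 := lt_of_le_of_ne h2 h3.symm
  exact (div_pos_iff_of_pos_right (by positivity)).1 h4

theorem IsBoundaryEigensystem.nonneg (hw : IsBoundaryEigensystem a H S μ w)
    (hA : IsAdmissible M a a₁ S) (hH : 0 < H) (i : Fin n) : 0 ≤ μ i := by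
  have h1 := hw.energy_eq i i
  rw [if_pos rfl] at h1
  have h2 : 0 ≤ energy a S (w i) (w i) := energy_self_nonneg (fun x hx => (hA.bounds x hx).1.le) _
  rw [h1] at h2
  by_contra hneg
  exact absurd h2 (not_le.2 (div_neg_of_neg_of_pos (not_le.1 hneg) hH))

/-- Only the first eigenvalue of the boundary problem can vanish. -/
theorem IsBoundaryEigensystem.pos (hw : IsBoundaryEigensystem a H S μ w)
    (hA : IsAdmissible M a a₁ S) (hH : 0 < H) (i : Fin n) (hi : 1 ≤ i.val) : 0 < μ i := by
  refine lt_of_le_of_ne (hw.nonneg hA hH i) fun h0 => ?_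
  -- If `μ i = 0` with `i ≥ 1`, ordering forces `μ j = 0` too, so both modes are constants, and two
  -- constants cannot be orthonormal on the boundary.
  let j : Fin n := ⟨0, by omega⟩
  have hji : j ≠ i := fun e => by
    have : (0 : ℕ) = i.val := congrArg Fin.val e
    omega
  have hj0 : μ j = 0 := le_antisymm
    (h0.symm ▸ hw.ordered (Fin.mk_le_of_le_val (Nat.zero_le _))) (hw.nonneg hA hH j)
  obtain ⟨C, hC⟩ := constant_of_energy_eq_zero hA.connected hA.measurable hA.bounds
    (hw.mem_femSpace i) (by rw [hw.energy_eq, if_pos rfl, ← h0, zero_div])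
  obtain ⟨D, hD⟩ := constant_of_energy_eq_zero hA.connected hA.measurable hA.bounds
    (hw.mem_femSpace j) (by rw [hw.energy_eq, if_pos rfl, hj0, zero_div])
  have hint : ∀ (u v : ℝ × ℝ → ℝ) (A B : ℝ), (∀ x ∈ region S, u x = A) →
      (∀ x ∈ region S, v x = B) → bdryIntegral S (fun x => u x * v x) =
        A * B * bdryIntegral S fun _ => 1 := by
    intro u v A B hu hv
    rw [bdryIntegral, bdryIntegral, lineIntegral, lineIntegral, ← integral_const_mul]
    refine setIntegral_congr_fun isClosed_frontier.measurableSet fun x hx => ?_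
    have hxS := frontier_subset_region S hx
    simp [hu x hxS, hv x hxS]
  have e1 := (hint _ _ _ _ hC hC).symm.trans (hw.orthonormal i i)
  have e2 := (hint _ _ _ _ hD hD).symm.trans (hw.orthonormal j j)
  have e3 := (hint _ _ _ _ hC hD).symm.trans (hw.orthonormal i j)
  rw [if_pos rfl] at e1 e2
  rw [if_neg hji.symm] at e3
  have e4 : C * C * (bdryIntegral S fun _ => 1) * (D * D * bdryIntegral S fun _ => 1) =
    (C * D * bdryIntegral S fun _ => 1) * (C * D * bdryIntegral S fun _ => 1) := by ring
  rw [e1, e2, e3] at e4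
  norm_num at e4

/-- Every boundary node has a discrete harmonic extension of its unit boundary function. -/
theorem IsInteriorEigensystem.exists_harmonicExtension (hz : IsInteriorEigensystem a H S ev z)
    (hA : IsAdmissible M a a₁ S) (hH : 0 < H) {x : ℝ × ℝ} (hx : x ∈ bdryNodes S) :
    ∃ W, IsNodalHarmonicExtension a S x W := by
  classical
  obtain ⟨g, hg, hgn⟩ := M.exists_mem_femSpace hA.subset (fun y => if y = x then 1 else 0)
  have hnode : ∀ y ∈ bdryNodes S, g y = if y = x then 1 else 0 :=
    fun y hy => hgn (mem_nodes.2 hy.2)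
  -- Minus the energy projection of `g` onto the interior space: `H ^ 2 / ev i` is the reciprocal of
  -- the energy of `z i`.
  set s : ℝ × ℝ → ℝ := ∑ i, (-(energy a S g (z i) * (H ^ 2 / ev i))) • z i with hs
  have hs0 : s ∈ femSpaceZero S :=
    Submodule.sum_mem _ fun i _ => Submodule.smul_mem _ _ (hz.mem i)
  have hm : g + s ∈ femSpace S := add_mem hg hs0.1
  have hz0 : ∀ j, energy a S (g + s) (z j) = 0 := by
    intro j
    rw [energy_add_left hA.measurable hA.abs_le hg hs0.1 (hz.mem_femSpace j), hs,
      energy_sum_left hA.measurable hA.abs_le _ _ hz.mem_femSpace (hz.mem_femSpace j)]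
    simp only [hz.energy_eq, mul_ite, mul_zero, Finset.sum_ite_eq', Finset.mem_univ, if_true]
    have := (hz.pos hA hH j).ne'
    field_simp
    ring
  refine ⟨g + s, hm, ?_, fun y hy hyx => ?_, fun v hv => ?_⟩
  · rw [Pi.add_apply, hs0.2 x hx.1, hnode x hx, if_pos rfl, add_zero]
  · rw [Pi.add_apply, hs0.2 y hy.1, hnode y hy, if_neg hyx, add_zero]
  · rw [← hz.span_eq, Submodule.mem_span_range_iff_exists_fun] at hv
    obtain ⟨c, rfl⟩ := hv
    rw [energy_comm, energy_sum_left hA.measurable hA.abs_le _ _ hz.mem_femSpace hm]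
    exact Finset.sum_eq_zero fun i _ => by rw [energy_comm, hz0, mul_zero]

/-- Every finite element function on a block is a combination of boundary and interior modes. -/
theorem exists_modal_expansion (hw : IsBoundaryEigensystem a H S μ w)
    (hz : IsInteriorEigensystem a H S ev z) (hA : IsAdmissible M a a₁ S) (hH : 0 < H)
    {v : ℝ × ℝ → ℝ} (hv : v ∈ femSpace S) :
    ∃ (c : Fin n → ℝ) (d : Fin n₀ → ℝ), v = ∑ i, c i • w i + ∑ i, d i • z i := by
  classical
  have hW : ∀ x, ∃ W, x ∈ bdryNodes S → IsNodalHarmonicExtension a S x W := by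
    intro x
    by_cases hx : x ∈ bdryNodes S
    · obtain ⟨W, h⟩ := hz.exists_harmonicExtension hA hH hx
      exact ⟨W, fun _ => h⟩
    · exact ⟨0, fun h => absurd h hx⟩
  choose W hW using hW
  set F := (finite_bdryNodes S).toFinset with hF
  have hFm : ∀ x, x ∈ F ↔ x ∈ bdryNodes S := fun x => (finite_bdryNodes S).mem_toFinset
  -- The harmonic function with the boundary nodal values of `v`; the difference then vanishes on
  -- the whole boundary.
  set v₁ : ℝ × ℝ → ℝ := ∑ x ∈ F, v x • W x with hv₁
  have h1 : v₁ ∈ snapshotSpace a S := Submodule.sum_mem _ fun x hx => Submodule.smul_mem _ _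
    (Submodule.subset_span ⟨x, (hFm x).1 hx, hW x ((hFm x).1 hx)⟩)
  have h2 : v - v₁ ∈ femSpaceZero S := by
    have hm := sub_mem hv (snapshotSpace_le a S h1)
    refine ⟨hm, fun y hy => M.eq_zero_of_bdryNodes hA.subset hm (fun y hy => ?_) hy⟩
    have : v₁ y = v y := by
      rw [hv₁, Finset.sum_apply, Finset.sum_eq_single_of_mem y ((hFm y).2 hy)]
      · simp [(hW y hy).node]
      · intro x hx hxy
        simp [(hW x ((hFm x).1 hx)).other y hy hxy.symm]
    rw [Pi.sub_apply, this, sub_self]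
  rw [← hw.span_eq, Submodule.mem_span_range_iff_exists_fun] at h1
  rw [← hz.span_eq, Submodule.mem_span_range_iff_exists_fun] at h2
  obtain ⟨c, hc⟩ := h1
  obtain ⟨d, hd⟩ := h2
  exact ⟨c, d, by rw [hc, hd]; abel⟩

/-- A combination of boundary modes has a variational normal flux. -/
theorem exists_isNormalFlux (hw : IsBoundaryEigensystem a H S μ w)
    (hz : IsInteriorEigensystem a H S ev z) (hA : IsAdmissible M a a₁ S) (hH : 0 < H)
    {u : ℝ × ℝ → ℝ} (hu : u ∈ snapshotSpace a S) : ∃ q, IsNormalFlux a S u q := by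
  have huf := snapshotSpace_le a S hu
  -- Riesz representative of the energy functional in the $L^2(\partial K)$-orthonormal boundary
  -- modes. Interior test modes contribute zero to both sides of Green's identity.
  set q : ℝ × ℝ → ℝ := ∑ i, energy a S u (w i) • w i with hq
  have hqm : q ∈ femSpace S :=
    Submodule.sum_mem _ fun i _ => Submodule.smul_mem _ _ (hw.mem_femSpace i)
  have hwL := fun i => memLp_frontier_of_mem (hw.mem_femSpace i)
  refine ⟨q, ⟨q, hqm, fun _ _ => rfl⟩, fun v hv => ?_⟩
  obtain ⟨b, d, rfl⟩ := exists_modal_expansion hw hz hA hH hv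
  have hb : (∑ i, b i • w i) ∈ femSpace S :=
    Submodule.sum_mem _ fun i _ => Submodule.smul_mem _ _ (hw.mem_femSpace i)
  have hd : (∑ i, d i • z i) ∈ femSpaceZero S :=
    Submodule.sum_mem _ fun i _ => Submodule.smul_mem _ _ (hz.mem i)
  have e1 : energy a S u (∑ i, b i • w i + ∑ i, d i • z i) = ∑ i, b i * energy a S u (w i) := by
    rw [energy_comm, energy_add_left hA.measurable hA.abs_le hb hd.1 huf,
      energy_comm a S (∑ i, d i • z i), hA.energy_snapshotSpace hu hd, add_zero,
      energy_sum_left hA.measurable hA.abs_le _ _ hw.mem_femSpace huf]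
    simp only [energy_comm a S u]
  have e2 : bdryIntegral S (fun x => q x * (∑ i, b i • w i + ∑ i, d i • z i) x) =
      ∫ x in frontier (region S), (∑ i, b i • w i) x * q x ∂(Measure.hausdorffMeasure 1) :=
    setIntegral_congr_fun isClosed_frontier.measurableSet fun x hx => by
      simp only [Pi.add_apply, hd.2 x hx, add_zero, mul_comm]
  rw [e1, e2, integral_sum_smul_mul _ hwL (memLp_frontier_of_mem hqm)]
  refine Finset.sum_congr rfl fun i _ => ?_
  congr 1
  simp_rw [mul_comm (w i _)]
  rw [hq, integral_sum_smul_mul _ hwL (hwL i)]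
  have ho : ∀ j, ∫ x in frontier (region S), w j x * w i x ∂(Measure.hausdorffMeasure 1) =
      if j = i then 1 else 0 := fun j => hw.orthonormal j i
  simp [ho]

/-! ### Truncation of modal expansions -/

theorem modalSum_eq_sum {n : ℕ} (c : Fin n → ℝ) (e : Fin n → ℝ × ℝ → ℝ) :
    modalSum n c e = ∑ i, c i • e i := by
  rw [modalSum, Finset.filter_true_of_mem fun i _ => i.isLt]

/-- The remainder `∑_{i > p} c_i e_i` of a modal expansion. -/
def modalTail {n : ℕ} (p : ℕ) (c : Fin n → ℝ) (e : Fin n → ℝ × ℝ → ℝ) : ℝ × ℝ → ℝ :=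
  ∑ i with ¬ i.val < p, c i • e i

theorem modalSum_add_modalTail {n : ℕ} (p : ℕ) (c : Fin n → ℝ) (e : Fin n → ℝ × ℝ → ℝ) :
    modalSum p c e + modalTail p c e = modalSum n c e := by
  rw [modalSum_eq_sum, modalSum, modalTail, Finset.sum_filter_add_sum_filter_not]

theorem modalTail_mem {n : ℕ} {V : Submodule ℝ (ℝ × ℝ → ℝ)} (p : ℕ) (c : Fin n → ℝ)
    {e : Fin n → ℝ × ℝ → ℝ} (he : ∀ i, e i ∈ V) : modalTail p c e ∈ V :=
  Submodule.sum_mem _ fun i _ => Submodule.smul_mem _ _ (he i)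

theorem modalSum_mem {n : ℕ} {V : Submodule ℝ (ℝ × ℝ → ℝ)} (p : ℕ) (c : Fin n → ℝ)
    {e : Fin n → ℝ × ℝ → ℝ} (he : ∀ i, e i ∈ V) : modalSum p c e ∈ V :=
  Submodule.sum_mem _ fun i _ => Submodule.smul_mem _ _ (he i)

theorem recipNext_nonneg {n : ℕ} {ν : Fin n → ℝ} (h : ∀ i, 0 ≤ ν i) (p : ℕ) :
    0 ≤ recipNext ν p := by
  unfold recipNext
  split_ifs with hp
  · exact one_div_nonneg.2 (h _)
  · rfl

/-- Positivity from `p` on is essential: a zero eigenvalue would have reciprocal `0`, not infinity.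
-/
theorem recipNext_antitone {n : ℕ} {ν : Fin n → ℝ} (hν : Monotone ν) (h0 : ∀ i, 0 ≤ ν i) {p k : ℕ}
    (hp : ∀ i : Fin n, p ≤ i.val → 0 < ν i) (hk : p ≤ k) : recipNext ν k ≤ recipNext ν p := by
  by_cases hkn : k < n
  · have hpn : p < n := hk.trans_lt hkn
    rw [recipNext, recipNext, dif_pos hkn, dif_pos hpn]
    exact one_div_le_one_div_of_le (hp _ le_rfl) (hν hk)
  · rw [recipNext, dif_neg hkn]
    exact recipNext_nonneg h0 p

theorem inv_le_recipNext {n : ℕ} {ν : Fin n → ℝ} (hν : Monotone ν) {p : ℕ}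
    (hp : ∀ i : Fin n, p ≤ i.val → 0 < ν i) {i : Fin n} (hi : p ≤ i.val) :
    (ν i)⁻¹ ≤ recipNext ν p := by
  have hpn : p < n := hi.trans_lt i.isLt
  rw [recipNext, dif_pos hpn, one_div]
  exact inv_anti₀ (hp _ le_rfl) (hν hi)

/-- On the tail `c i = (s / ν i) * G i`, so the summands are `(s / ν i) * G i ^ 2` and `(s / ν i) ^
2 * G i ^ 2`. The largest factor is that of the first omitted eigenvalue, and `Q` is the Bessel
bound for the data coefficients `G`. -/
theorem sum_tail_le {n : ℕ} {ν c G : Fin n → ℝ} {s Q : ℝ} (hs : 0 < s) (hν : Monotone ν) {p : ℕ}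
    (hp : ∀ i : Fin n, p ≤ i.val → 0 < ν i) (hG : ∀ i, c i * (ν i / s) = G i)
    (hQ : ∑ i, G i ^ 2 ≤ Q) (h0 : ∀ i, 0 ≤ ν i) :
    ∑ i with ¬ i.val < p, c i ^ 2 * (ν i / s) ≤ s * recipNext ν p * Q ∧
    ∑ i with ¬ i.val < p, c i ^ 2 ≤ (s * recipNext ν p) ^ 2 * Q := by
  have hr := recipNext_nonneg h0 p
  have hsub : ∑ i with ¬ i.val < p, G i ^ 2 ≤ Q :=
    (Finset.sum_le_sum_of_subset_of_nonneg (Finset.filter_subset _ _)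
      fun i _ _ => sq_nonneg (G i)).trans hQ
  constructor
  · refine le_trans ?_ (mul_le_mul_of_nonneg_left hsub (by positivity))
    rw [Finset.mul_sum]
    refine Finset.sum_le_sum fun i hi => ?_
    have hi' : p ≤ i.val := not_lt.1 (Finset.mem_filter.1 hi).2
    have hpos := hp i hi'
    have e : c i ^ 2 * (ν i / s) = s * (ν i)⁻¹ * G i ^ 2 := by
      rw [← hG i]; field_simp
    rw [e]
    have := inv_le_recipNext hν hp hi'
    gcongr
  · refine le_trans ?_ (mul_le_mul_of_nonneg_left hsub (by positivity))
    rw [Finset.mul_sum]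
    refine Finset.sum_le_sum fun i hi => ?_
    have hi' : p ≤ i.val := not_lt.1 (Finset.mem_filter.1 hi).2
    have hpos := hp i hi'
    have e : c i ^ 2 = (s * (ν i)⁻¹) ^ 2 * G i ^ 2 := by
      rw [← hG i]; field_simp
    rw [e]
    have := inv_le_recipNext hν hp hi'
    gcongr

/-- The remainder of the boundary modes, in the energy and in `L²(∂K)`. -/
theorem IsBoundaryEigensystem.tail_le (hw : IsBoundaryEigensystem a H S μ w)
    (hA : IsAdmissible M a a₁ S) (hH : 0 < H) {c : Fin n → ℝ} {q : ℝ × ℝ → ℝ}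
    (hq : IsNormalFlux a S (modalSum n c w) q) {p : ℕ} (hp : 1 ≤ p) :
    energy a S (modalTail p c w) (modalTail p c w) ≤
      H * recipNext μ p * bdryIntegral S (fun x => q x ^ 2) ∧
    bdryIntegral S (fun x => modalTail p c w x ^ 2) ≤
      (H * recipNext μ p) ^ 2 * bdryIntegral S (fun x => q x ^ 2) := by
  have hwL := fun i => memLp_frontier_of_mem (hw.mem_femSpace i)
  have ho : ∀ i j, ∫ x in frontier (region S), w i x * w j x ∂(Measure.hausdorffMeasure 1) =
      if i = j then 1 else 0 := hw.orthonormal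
  have hqL : MemLp q 2 ((Measure.hausdorffMeasure 1).restrict (frontier (region S))) := by
    obtain ⟨g, hg, hqg⟩ := hq.trace
    exact (memLp_congr_ae (ae_restrict_of_forall_mem isClosed_frontier.measurableSet hqg)).2
      (memLp_frontier_of_mem hg)
  have htm : modalTail p c w ∈ femSpace S := modalTail_mem p c hw.mem_femSpace
  -- Green's identity tested with one mode: the Fourier coefficients of the flux.
  have hG : ∀ i, c i * (μ i / H) = bdryIntegral S (fun x => q x * w i x) := by
    intro i
    rw [hq.green _ (hw.mem_femSpace i), modalSum_eq_sum,
      energy_sum_left hA.measurable hA.abs_le _ _ hw.mem_femSpace (hw.mem_femSpace i)]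
    simp [hw.energy_eq]
  have hQ : ∑ i, (bdryIntegral S (fun x => q x * w i x)) ^ 2 ≤
      bdryIntegral S (fun x => q x ^ 2) := sum_sq_integral_mul_le hwL ho hqL
  have key := sum_tail_le hH hw.ordered (p := p)
    (fun i hi => hw.pos hA hH i (hp.trans hi)) hG hQ (hw.nonneg hA hH)
  have e1 : energy a S (modalTail p c w) (modalTail p c w) =
      ∑ i with ¬ i.val < p, c i ^ 2 * (μ i / H) := by
    rw [modalTail] at htm ⊢
    rw [energy_sum_left hA.measurable hA.abs_le _ _ hw.mem_femSpace htm]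
    refine Finset.sum_congr rfl fun i hi => ?_
    rw [energy_comm,
      energy_sum_left hA.measurable hA.abs_le _ _ hw.mem_femSpace (hw.mem_femSpace i)]
    simp only [hw.energy_eq, mul_ite, mul_zero, Finset.sum_ite_eq', hi, if_true]
    ring
  have e2 : bdryIntegral S (fun x => modalTail p c w x ^ 2) = ∑ i with ¬ i.val < p, c i ^ 2 := by
    have e3 : bdryIntegral S (fun x => modalTail p c w x ^ 2) =
        ∫ x in frontier (region S), (∑ i with ¬ i.val < p, c i • w i) x * modalTail p c w x
          ∂(Measure.hausdorffMeasure 1) := by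
      simp only [sq, bdryIntegral, lineIntegral, modalTail]
    rw [e3, integral_sum_smul_mul _ hwL (memLp_frontier_of_mem htm)]
    refine Finset.sum_congr rfl fun i hi => ?_
    simp_rw [mul_comm (w i _)]
    rw [modalTail, integral_sum_smul_mul _ hwL (hwL i)]
    simp only [ho, mul_ite, mul_zero, Finset.sum_ite_eq', hi, if_true]
    ring
  rw [e1, e2]
  exact key

/-- The remainder of the interior modes in the energy. -/
theorem IsInteriorEigensystem.tail_le (hz : IsInteriorEigensystem a H S ev z)
    (hA : IsAdmissible M a a₁ S) (hH : 0 < H) {d : Fin n₀ → ℝ} {g : ℝ × ℝ → ℝ}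
    (hg : MemLp g 2 (volume.restrict (region S)))
    (hd : ∀ v ∈ femSpaceZero S, energy a S (modalSum n₀ d z) v = ∫ x in region S, g x * v x)
    (m : ℕ) :
    energy a S (modalTail m d z) (modalTail m d z) ≤
      H ^ 2 * recipNext ev m * ∫ x in region S, g x ^ 2 := by
  have htm : modalTail m d z ∈ femSpace S := modalTail_mem m d hz.mem_femSpace
  have hG : ∀ i, d i * (ev i / H ^ 2) = ∫ x in region S, g x * z i x := by
    intro i
    rw [← hd _ (hz.mem i), modalSum_eq_sum,
      energy_sum_left hA.measurable hA.abs_le _ _ hz.mem_femSpace (hz.mem_femSpace i)]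
    simp [hz.energy_eq]
  have hQ := sum_sq_integral_mul_le (fun i => memLp_region_of_mem (hz.mem_femSpace i))
    hz.orthonormal hg
  have key := sum_tail_le (s := H ^ 2) (by positivity) hz.ordered (p := m)
    (fun i _ => hz.pos hA hH i) hG hQ fun i => (hz.pos hA hH i).le
  refine le_trans (le_of_eq ?_) key.1
  rw [modalTail] at htm ⊢
  rw [energy_sum_left hA.measurable hA.abs_le _ _ hz.mem_femSpace htm]
  refine Finset.sum_congr rfl fun i hi => ?_
  rw [energy_comm,
    energy_sum_left hA.measurable hA.abs_le _ _ hz.mem_femSpace (hz.mem_femSpace i)]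
  simp only [hz.energy_eq, mul_ite, mul_zero, Finset.sum_ite_eq', hi, if_true]
  ring

/-! ### Jumps across the coarse edges -/

theorem sum_setIntegral_le {X ι : Type*} [MeasurableSpace X] [Fintype ι] {ν : Measure X}
    {A : ι → Set X} {Γ : Set X} (hA : ∀ i, MeasurableSet (A i))
    (hd : Pairwise (Function.onFun (AEDisjoint ν) A)) (hsub : ∀ i, A i ⊆ Γ) {F : X → ℝ}
    (hF0 : ∀ x, 0 ≤ F x) (hF : IntegrableOn F Γ ν) :
    ∑ i, ∫ x in A i, F x ∂ν ≤ ∫ x in Γ, F x ∂ν := by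
  have hU : (⋃ i, A i) ⊆ Γ := iUnion_subset hsub
  have h1 := hasSum_integral_iUnion_ae (fun i => (hA i).nullMeasurableSet) hd (hF.mono_set hU)
  rw [(hasSum_fintype _).unique h1]
  exact setIntegral_mono_set hF (.of_forall hF0) hU.eventuallyLE

/-- The parts of the boundary of the block `k`: its interfaces with the other blocks, and its part
of the boundary of the domain. -/
def boundaryPart {ι : Type*} (M : FineMesh) (block : ι → Finset Rect) (k : ι) :
    Option ι → Set (ℝ × ℝ)
  | none => region (block k) ∩ frontier (region M.cells)
  -- The condition `l ≠ k` makes the diagonal part empty; otherwise it would be the whole block.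
  | some l => {x | l ≠ k ∧ x ∈ region (block k) ∩ region (block l)}

section

variable {ι : Type*} {block : ι → Finset Rect}

theorem boundaryPart_some {k l : ι} (h : l ≠ k) :
    boundaryPart M block k (some l) = region (block k) ∩ region (block l) := by
  simp [boundaryPart, h]

theorem isClosed_boundaryPart (k : ι) (o : Option ι) : IsClosed (boundaryPart M block k o) := by
  cases o with
  | none => exact (isClosed_region _).inter isClosed_frontier
  | some l =>
    by_cases h : l = k
    · simp [boundaryPart, h]
    · rw [boundaryPart_some h]
      exact (isClosed_region _).inter (isClosed_region _)

theorem IsCoarseMesh.ne_of_mem (hb : IsCoarseMesh M block) {k l : ι} (h : k ≠ l) {R R' : Rect}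
    (hR : R ∈ block k) (hR' : R' ∈ block l) : R ≠ R' := by
  rintro rfl
  exact h ((hb.partition R (hb.subset k hR)).unique hR hR')

theorem IsCoarseMesh.boundaryPart_subset (hb : IsCoarseMesh M block) (k : ι) (o : Option ι) :
    boundaryPart M block k o ⊆ frontier (region (block k)) := by
  cases o with
  | none =>
    rintro x ⟨hx, hx'⟩
    rw [(isClosed_region _).frontier_eq] at hx' ⊢
    exact ⟨hx, fun h => hx'.2 (interior_mono (region_mono (hb.subset k)) h)⟩
  | some l =>
    rintro x ⟨hlk, hx, hx'⟩
    obtain ⟨R, hR, hxR⟩ := mem_region.1 hx'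
    exact M.mem_frontier_of_mem_other (hb.subset k) (hb.subset l hR)
      (fun h => hb.ne_of_mem hlk hR h rfl) hx hxR

/-- A common non-vertex point of two blocks is interior to the union of one cell from each. This
leaves no room for a third block or for the boundary of the domain. -/
theorem IsCoarseMesh.boundaryPart_inter_subset (hb : IsCoarseMesh M block) (k : ι)
    {o o' : Option ι} (h : o ≠ o') :
    boundaryPart M block k o ∩ boundaryPart M block k o' ⊆ nodes M.cells := by
  have key : ∀ l o', some l ≠ o' →
      boundaryPart M block k (some l) ∩ boundaryPart M block k o' ⊆ nodes M.cells := by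
    rintro l o' h x ⟨⟨hlk, hx, hxl⟩, hx'⟩
    by_contra hn
    obtain ⟨R, hR, hxR⟩ := mem_region.1 hx
    obtain ⟨R', hR', hxR'⟩ := mem_region.1 hxl
    have hi := M.mem_interior_union (hb.subset k hR) (hb.subset l hR')
      (hb.ne_of_mem hlk.symm hR hR') hxR hxR' fun hc => hn (mem_nodes.2 ⟨R, hb.subset k hR, hc⟩)
    cases o' with
    | none =>
      have h2 := hx'.2
      rw [(isClosed_region _).frontier_eq] at h2
      exact h2.2 (interior_mono (union_subset (carrier_subset_region (hb.subset k hR))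
        (carrier_subset_region (hb.subset l hR'))) hi)
    | some l' =>
      obtain ⟨hlk', -, hxl'⟩ := hx'
      obtain ⟨R'', hR'', hxR''⟩ := mem_region.1 hxl'
      rw [← R''.closure_interior] at hxR''
      obtain ⟨y, hy, hy'⟩ := mem_closure_iff.1 hxR'' _ isOpen_interior hi
      rcases interior_subset hy with h1 | h1
      · exact M.notMem_interior (hb.subset _ hR'') (hb.subset _ hR)
          (hb.ne_of_mem hlk' hR'' hR) h1 hy'
      · exact M.notMem_interior (hb.subset _ hR'') (hb.subset _ hR')
          (hb.ne_of_mem (fun e => h (congrArg some e.symm)) hR'' hR') h1 hy'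
  cases o with
  | some l => exact key l o' h
  | none =>
    cases o' with
    | none => exact absurd rfl h
    | some l =>
      rw [inter_comm]
      exact key l none h.symm

theorem IsCoarseMesh.aedisjoint_boundaryPart (hb : IsCoarseMesh M block) (k : ι) :
    Pairwise (Function.onFun (AEDisjoint (Measure.hausdorffMeasure 1))
      (boundaryPart M block k)) := by
  intro o o' h
  have := Measure.nullSingletonClass_hausdorff (ℝ × ℝ) (d := 1) one_pos
  exact measure_mono_null (hb.boundaryPart_inter_subset k h) ((finite_nodes _).measure_zero _)

theorem mul_sq_sub_le {α a₁ s t : ℝ} (h0 : 0 ≤ α) (h1 : α ≤ a₁) :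
    α * (s - t) ^ 2 ≤ 2 * a₁ * (s ^ 2 + t ^ 2) := by
  have h2 : (s - t) ^ 2 ≤ 2 * (s ^ 2 + t ^ 2) := by nlinarith [sq_nonneg (s + t)]
  calc α * (s - t) ^ 2 ≤ a₁ * (2 * (s ^ 2 + t ^ 2)) := mul_le_mul h1 h2 (sq_nonneg _) (h0.trans h1)
    _ = 2 * a₁ * (s ^ 2 + t ^ 2) := by ring

/-- The jump terms are bounded by the traces of the single functions. -/
theorem IsCoarseMesh.jump_le [Fintype ι] (hb : IsCoarseMesh M block) {a : ℝ × ℝ → ℝ} {a₁ : ℝ}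
    (hA : ∀ k, IsAdmissible M a a₁ (block k)) {U : ι → ℝ × ℝ → ℝ}
    (hU : ∀ k, ContinuousOn (U k) (frontier (region (block k)))) :
    (1 / 2) * (∑ k, ∑ l, lineIntegral (region (block k) ∩ region (block l))
        (fun x => a x * (U k x - U l x) ^ 2)) +
      ∑ k, lineIntegral (region (block k) ∩ frontier (region M.cells))
        (fun x => a x * (U k x) ^ 2) ≤
    2 * a₁ * ∑ k, bdryIntegral (block k) (fun x => U k x ^ 2) := by
  -- The sign of `a₁` is read off at a point of a block; without blocks nothing forces it.
  have ha₁ : ∀ k : ι, 0 ≤ a₁ := fun k => by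
    obtain ⟨x, hx⟩ := (hA k).connected.nonempty
    exact ((hA k).bounds x hx).1.le.trans ((hA k).bounds x hx).2
  have hint : ∀ k, IntegrableOn (fun x => U k x ^ 2) (frontier (region (block k)))
      (Measure.hausdorffMeasure 1) := fun k =>
    (memLp_two_of_continuousOn (isCompact_frontier_region _)
      (hausdorffMeasure_frontier_region_lt_top _) (hU k)).integrable_sq
  have hintp : ∀ k o, IntegrableOn (fun x => U k x ^ 2) (boundaryPart M block k o)
      (Measure.hausdorffMeasure 1) := fun k o => (hint k).mono_set (hb.boundaryPart_subset k o)
  set J : ι → Option ι → ℝ := fun k o =>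
    ∫ x in boundaryPart M block k o, U k x ^ 2 ∂(Measure.hausdorffMeasure 1) with hJ
  have hJ0 : ∀ k o, 0 ≤ J k o := fun k o => integral_nonneg fun x => sq_nonneg _
  have hI : ∀ k l, lineIntegral (region (block k) ∩ region (block l))
      (fun x => a x * (U k x - U l x) ^ 2) ≤ 2 * a₁ * (J k (some l) + J l (some k)) := by
    intro k l
    by_cases hlk : l = k
    · subst hlk
      have := hJ0 l (some l)
      have := ha₁ l
      simp only [sub_self, lineIntegral, ne_eq, OfNat.ofNat_ne_zero, not_false_eq_true, zero_pow,
        mul_zero, integral_zero]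
      positivity
    · have hk := hintp k (some l)
      have hl := hintp l (some k)
      simp only [hJ]
      rw [boundaryPart_some hlk] at hk ⊢
      rw [boundaryPart_some (Ne.symm hlk), inter_comm (region (block l))] at hl ⊢
      rw [← integral_add hk hl, ← integral_const_mul]
      have hm : MeasurableSet (region (block k) ∩ region (block l)) :=
        (measurableSet_region _).inter (measurableSet_region _)
      refine integral_mono_of_nonneg (ae_restrict_of_forall_mem hm fun x hx =>
        mul_nonneg ((hA k).bounds x hx.1).1.le (sq_nonneg _)) ((hk.add hl).const_mul _)
        (ae_restrict_of_forall_mem hm fun x hx =>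
          mul_sq_sub_le ((hA k).bounds x hx.1).1.le ((hA k).bounds x hx.1).2)
  have hB : ∀ k, lineIntegral (region (block k) ∩ frontier (region M.cells))
      (fun x => a x * (U k x) ^ 2) ≤ 2 * a₁ * J k none := by
    intro k
    have hm : MeasurableSet (region (block k) ∩ frontier (region M.cells)) :=
      (measurableSet_region _).inter isClosed_frontier.measurableSet
    have h1 : lineIntegral (region (block k) ∩ frontier (region M.cells))
        (fun x => a x * (U k x) ^ 2) ≤ a₁ * J k none := by
      simp only [hJ]
      rw [← integral_const_mul]
      exact integral_mono_of_nonneg (ae_restrict_of_forall_mem hm fun x hx =>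
        mul_nonneg ((hA k).bounds x hx.1).1.le (sq_nonneg _)) ((hintp k none).const_mul _)
        (ae_restrict_of_forall_mem hm fun x hx =>
          mul_le_mul_of_nonneg_right ((hA k).bounds x hx.1).2 (sq_nonneg _))
    -- On the domain boundary `a₁` suffices; it is doubled to match the interfaces.
    nlinarith [mul_nonneg (ha₁ k) (hJ0 k none)]
  have hsum : ∀ k, ∑ o, J k o ≤ bdryIntegral (block k) (fun x => U k x ^ 2) := fun k =>
    sum_setIntegral_le (fun o => (isClosed_boundaryPart k o).measurableSet)
      (hb.aedisjoint_boundaryPart k) (hb.boundaryPart_subset k) (fun x => sq_nonneg _) (hint k)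
  have h1 : (1 / 2) * (∑ k, ∑ l, lineIntegral (region (block k) ∩ region (block l))
      (fun x => a x * (U k x - U l x) ^ 2)) ≤ 2 * a₁ * ∑ k, ∑ l, J k (some l) := by
    have h2 := Finset.sum_le_sum fun k (_ : k ∈ Finset.univ) =>
      Finset.sum_le_sum fun l (_ : l ∈ Finset.univ) => hI k l
    simp only [← Finset.mul_sum, Finset.sum_add_distrib] at h2
    -- After swapping indices both trace sums coincide; this doubling cancels the factor `1 / 2`.
    rw [Finset.sum_comm (f := fun k l => J l (some k))] at h2
    linarith
  calc _ ≤ 2 * a₁ * ∑ k, ∑ l, J k (some l) + ∑ k, 2 * a₁ * J k none :=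
        add_le_add h1 (Finset.sum_le_sum fun k _ => hB k)
    _ = ∑ k, 2 * a₁ * ∑ o, J k o := by
        simp only [Fintype.sum_option, mul_add, Finset.sum_add_distrib, ← Finset.mul_sum]
        ring
    _ ≤ ∑ k, 2 * a₁ * bdryIntegral (block k) (fun x => U k x ^ 2) :=
        Finset.sum_le_sum fun k _ => mul_le_mul_of_nonneg_left (hsum k)
          (by have := ha₁ k; positivity)
    _ = _ := by rw [Finset.mul_sum]

end

/-! ### The error on one block -/

theorem IsModalExpansion.eqOn_error {S : Finset Rect} {n n₀ : ℕ} {w : Fin n → ℝ × ℝ → ℝ}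
    {z : Fin n₀ → ℝ × ℝ → ℝ} {u : ℝ × ℝ → ℝ} {c : Fin n → ℝ} {d : Fin n₀ → ℝ}
    (hx : IsModalExpansion S w z u c d) (p m : ℕ) :
    EqOn (u - (modalSum p c w + modalSum m d z)) (modalTail p c w + modalTail m d z)
      (region S) := by
  intro x hxS
  have h1 := congrFun (modalSum_add_modalTail p c w) x
  have h2 := congrFun (modalSum_add_modalTail m d z) x
  simp only [Pi.add_apply] at h1 h2
  simp only [Pi.sub_apply, Pi.add_apply, hx x hxS, ← h1, ← h2]
  ring

/-- Both time derivatives stay in the finite element space, so the second one is square integrable.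
-/
theorem IsSemidiscreteSolution.memLp {a : ℝ × ℝ → ℝ} {T : ℝ} {f u ut utt : ℝ → ℝ × ℝ → ℝ}
    (hu : IsSemidiscreteSolution M a T f u ut utt) (hT : 0 < T) {t : ℝ} (ht : t ∈ Icc 0 T) :
    MemLp (utt t) 2 (volume.restrict (region M.cells)) :=
  memLp_region_of_mem (mem_femSpace_of_hasDerivWithinAt hT
    (fun _ hs => mem_femSpace_of_hasDerivWithinAt hT (fun _ hr => (hu.mem _ hr).1) hu.deriv_one hs)
    hu.deriv_two ht)

/-- The interior part of the solution solves the local problem with the source `f - u_tt`. -/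
theorem IsSemidiscreteSolution.energy_interior {a : ℝ × ℝ → ℝ} {a₁ H T : ℝ}
    {f u ut utt : ℝ → ℝ × ℝ → ℝ} (hu : IsSemidiscreteSolution M a T f u ut utt) (hT : 0 < T)
    {t : ℝ} (ht : t ∈ Icc 0 T) (hf : MemLp (f t) 2 (volume.restrict (region M.cells)))
    {S : Finset Rect} (hA : IsAdmissible M a a₁ S) {n n₀ : ℕ} {μ : Fin n → ℝ}
    {w : Fin n → ℝ × ℝ → ℝ} (hw : IsBoundaryEigensystem a H S μ w) {ev : Fin n₀ → ℝ}
    {z : Fin n₀ → ℝ × ℝ → ℝ} (hz : IsInteriorEigensystem a H S ev z) {c : Fin n → ℝ}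
    {d : Fin n₀ → ℝ} (hx : IsModalExpansion S w z (u t) c d) {v : ℝ × ℝ → ℝ}
    (hv : v ∈ femSpaceZero S) :
    energy a S (modalSum n₀ d z) v = ∫ x in region S, (f t x - utt t x) * v x := by
  have hv0 : ∀ x, x ∉ region S → v x = 0 := hv.1.2.2
  have hrestr : ∀ g : ℝ × ℝ → ℝ, ∫ x in region M.cells, g x * v x = ∫ x in region S, g x * v x :=
    fun g => setIntegral_eq_of_subset_of_forall_sdiff_eq_zero (measurableSet_region _)
      (region_mono hA.subset) fun x hx => by rw [hv0 x hx.2, mul_zero]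
  have h1 := hu.eqn t ht v (M.femSpaceZero_le hA.subset hv)
  -- The boundary modes drop out by energy orthogonality.
  have he : energy a S (u t) v = energy a S (modalSum n₀ d z) v := by
    rw [energy_congr_left (u' := modalSum n c w + modalSum n₀ d z) hx,
      energy_add_left hA.measurable hA.abs_le (modalSum_mem n c hw.mem_femSpace)
        (modalSum_mem n₀ d hz.mem_femSpace) hv.1,
      hA.energy_snapshotSpace (modalSum_mem n c hw.mem) hv, zero_add]
  rw [energy_eq_of_support hA.subset a _ hv0, he, hrestr, hrestr] at h1
  have hsub : volume.restrict (region S) ≤ volume.restrict (region M.cells) :=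
    Measure.restrict_mono (region_mono hA.subset) le_rfl
  have hvL := memLp_region_of_mem hv.1
  simp only [sub_mul]
  rw [integral_sub (integrable_mul_of_memLp_two (hf.mono_measure hsub) hvL)
    (integrable_mul_of_memLp_two ((hu.memLp hT ht).mono_measure hsub) hvL)]
  linarith

/-- The energies of the two remainders add up. -/
theorem energy_error {a : ℝ × ℝ → ℝ} {a₁ H : ℝ} {S : Finset Rect}
    (hA : IsAdmissible M a a₁ S) {n n₀ : ℕ} {μ : Fin n → ℝ} {w : Fin n → ℝ × ℝ → ℝ}
    (hw : IsBoundaryEigensystem a H S μ w) {ev : Fin n₀ → ℝ} {z : Fin n₀ → ℝ × ℝ → ℝ}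
    (hz : IsInteriorEigensystem a H S ev z) {c : Fin n → ℝ} {d : Fin n₀ → ℝ} {u : ℝ × ℝ → ℝ}
    (hx : IsModalExpansion S w z u c d) (p m : ℕ) :
    energy a S (u - (modalSum p c w + modalSum m d z)) (u - (modalSum p c w + modalSum m d z)) =
      energy a S (modalTail p c w) (modalTail p c w) +
        energy a S (modalTail m d z) (modalTail m d z) := by
  have h1 : modalTail p c w ∈ snapshotSpace a S := modalTail_mem p c hw.mem
  have h1' := snapshotSpace_le a S h1
  have h2 : modalTail m d z ∈ femSpaceZero S := modalTail_mem m d hz.mem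
  have h12 := add_mem h1' h2.1
  rw [energy_congr (hx.eqOn_error p m) (hx.eqOn_error p m),
    energy_add_left hA.measurable hA.abs_le h1' h2.1 h12,
    energy_comm a S (modalTail p c w) (modalTail p c w + modalTail m d z),
    energy_comm a S (modalTail m d z) (modalTail p c w + modalTail m d z),
    energy_add_left hA.measurable hA.abs_le h1' h2.1 h1',
    energy_add_left hA.measurable hA.abs_le h1' h2.1 h2.1,
    energy_comm a S (modalTail m d z) (modalTail p c w), hA.energy_snapshotSpace h1 h2]
  ring

end GMsFEM

end

/-! ### Assembly of the block estimates -/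

theorem mainTheorem1 {ι : Type*} [Fintype ι]
    (M : GMsFEM.FineMesh) (block : ι → Finset GMsFEM.Rect)
    (hblock : GMsFEM.IsCoarseMesh M block)
    -- the coefficient
    (a : ℝ × ℝ → ℝ) (a₀ a₁ : ℝ) (ha : Measurable a) (ha₀ : 0 < a₀)
    (hbound : ∀ x ∈ GMsFEM.region M.cells, a₀ ≤ a x ∧ a x ≤ a₁)
    -- the mesh sizes and the penalty parameter
    (h H γ : ℝ) (hh : 0 < h) (hH : 0 < H) (hγ : 0 < γ)
    -- the source term and the finite element solution
    (T : ℝ) (hT : 0 < T) (f uh uh_t uh_tt : ℝ → ℝ × ℝ → ℝ)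
    (hf : ∀ t ∈ Set.Icc 0 T,
      MeasureTheory.MemLp (f t) 2 (MeasureTheory.volume.restrict (GMsFEM.region M.cells)))
    (huh : GMsFEM.IsSemidiscreteSolution M a T f uh uh_t uh_tt)
    -- the local spectral problems
    (n n₀ : ι → ℕ)
    (mu : ∀ k, Fin (n k) → ℝ) (w : ∀ k, Fin (n k) → ℝ × ℝ → ℝ)
    (hw : ∀ k, GMsFEM.IsBoundaryEigensystem a H (block k) (mu k) (w k))
    (lam : ∀ k, Fin (n₀ k) → ℝ) (z : ∀ k, Fin (n₀ k) → ℝ × ℝ → ℝ)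
    (hz : ∀ k, GMsFEM.IsInteriorEigensystem a H (block k) (lam k) (z k))
    (t : ℝ) (ht : t ∈ Set.Icc 0 T) :
    (∃ (c : ∀ k, Fin (n k) → ℝ) (d : ∀ k, Fin (n₀ k) → ℝ),
      ∀ k, GMsFEM.IsModalExpansion (block k) (w k) (z k) (uh t) (c k) (d k)) ∧
    ∀ (c : ∀ k, Fin (n k) → ℝ) (d : ∀ k, Fin (n₀ k) → ℝ),
      (∀ k, GMsFEM.IsModalExpansion (block k) (w k) (z k) (uh t) (c k) (d k)) →
      (∃ q : ι → ℝ × ℝ → ℝ,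
        ∀ k, GMsFEM.IsNormalFlux a (block k) (GMsFEM.modalSum (n k) (c k) (w k)) (q k)) ∧
      ∀ q : ι → ℝ × ℝ → ℝ,
        (∀ k, GMsFEM.IsNormalFlux a (block k) (GMsFEM.modalSum (n k) (c k) (w k)) (q k)) →
        ∀ p m : ι → ℕ, (∀ k, 1 ≤ p k ∧ p k ≤ n k) → (∀ k, m k ≤ n₀ k) →
          -- the spectral estimate
          (GMsFEM.aNormSq M block a γ h (fun k => uh t -
              (GMsFEM.modalSum (p k) (c k) (w k) + GMsFEM.modalSum (m k) (d k) (z k)))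
            ≤ ∑ k, (H * GMsFEM.recipNext (mu k) (p k) *
                  (1 + 2 * a₁ * γ * H / h * GMsFEM.recipNext (mu k) (p k)) *
                  GMsFEM.bdryIntegral (block k) (fun x => q k x ^ 2) +
                H ^ 2 * GMsFEM.recipNext (lam k) (m k) *
                  ∫ x in GMsFEM.region (block k), (f t x - uh_tt t x) ^ 2)) ∧
          -- the rate, with constants that do not depend on the numbers of modes
          (GMsFEM.aNormSq M block a γ h (fun k => uh t -
              (GMsFEM.modalSum (p k) (c k) (w k) + GMsFEM.modalSum (m k) (d k) (z k)))
            ≤ ∑ k, ((H * (1 + 2 * a₁ * γ * H / h * GMsFEM.recipNext (mu k) 1) *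
                    GMsFEM.bdryIntegral (block k) (fun x => q k x ^ 2)) *
                  GMsFEM.recipNext (mu k) (p k) +
                (H ^ 2 * ∫ x in GMsFEM.region (block k), (f t x - uh_tt t x) ^ 2) *
                  GMsFEM.recipNext (lam k) (m k))) := by
  have hA : ∀ k, GMsFEM.IsAdmissible M a a₁ (block k) := fun k =>
    ⟨hblock.subset k, hblock.connected k, ha, fun x hx => by
      have := hbound x (GMsFEM.region_mono (hblock.subset k) hx)
      exact ⟨ha₀.trans_le this.1, this.2⟩⟩
  have huV : uh t ∈ GMsFEM.femSpace M.cells := (huh.mem t ht).1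
  refine ⟨?_, fun c d hcd => ⟨?_, fun q hq p m hp _ => ?_⟩⟩
  · have hex : ∀ k, ∃ (c : Fin (n k) → ℝ) (d : Fin (n₀ k) → ℝ),
        GMsFEM.IsModalExpansion (block k) (w k) (z k) (uh t) c d := by
      intro k
      obtain ⟨c, d, h⟩ := GMsFEM.exists_modal_expansion (hw k) (hz k) (hA k) hH
        (GMsFEM.indicator_mem_femSpace (hblock.subset k) huV)
      refine ⟨c, d, fun x hx => ?_⟩
      rw [GMsFEM.modalSum_eq_sum, GMsFEM.modalSum_eq_sum, ← Pi.add_apply, ← h,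
        Set.indicator_of_mem hx]
    choose c d h using hex
    exact ⟨c, d, h⟩
  · have hex := fun k => GMsFEM.exists_isNormalFlux (hw k) (hz k) (hA k) hH
      (GMsFEM.modalSum_mem (n k) (c k) (hw k).mem)
    choose q hq using hex
    exact ⟨q, hq⟩
  have hr0 : ∀ k j, 0 ≤ GMsFEM.recipNext (mu k) j := fun k j =>
    GMsFEM.recipNext_nonneg ((hw k).nonneg (hA k) hH) j
  have hQ0 : ∀ k, 0 ≤ GMsFEM.bdryIntegral (block k) (fun x => q k x ^ 2) := fun k =>
    integral_nonneg fun x => sq_nonneg _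
  have ha₁ : ∀ k : ι, 0 ≤ a₁ := fun k => by
    obtain ⟨x, hx⟩ := (hA k).connected.nonempty
    exact ((hA k).bounds x hx).1.le.trans ((hA k).bounds x hx).2
  have hfg : ∀ k, MemLp (fun x => f t x - uh_tt t x) 2
      (volume.restrict (GMsFEM.region (block k))) := fun k =>
    ((hf t ht).sub (huh.memLp hT ht)).mono_measure
      (Measure.restrict_mono (GMsFEM.region_mono (hblock.subset k)) le_rfl)
  have hT1 := fun k => (hw k).tail_le (hA k) hH (hq k) (hp k).1
  have hT2 := fun k => (hz k).tail_le (hA k) hH (hfg k) (fun v hv =>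
    huh.energy_interior hT ht (hf t ht) (hA k) (hw k) (hz k) (hcd k) hv) (m k)
  have hcont : ∀ k, ContinuousOn (uh t -
      (GMsFEM.modalSum (p k) (c k) (w k) + GMsFEM.modalSum (m k) (d k) (z k)))
      (frontier (GMsFEM.region (block k))) := fun k =>
    ((huV.1.mono (GMsFEM.region_mono (hblock.subset k))).sub
      ((GMsFEM.modalSum_mem (p k) (c k) (hw k).mem_femSpace).1.add
        (GMsFEM.modalSum_mem (m k) (d k) (hz k).mem_femSpace).1)).mono
      (GMsFEM.frontier_subset_region _)
  -- The interior tail vanishes on the block boundary, so only the boundary tail enters the penalty.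
  have htrace : ∀ k, GMsFEM.bdryIntegral (block k) (fun x => (uh t -
      (GMsFEM.modalSum (p k) (c k) (w k) + GMsFEM.modalSum (m k) (d k) (z k))) x ^ 2) =
      GMsFEM.bdryIntegral (block k) (fun x => GMsFEM.modalTail (p k) (c k) (w k) x ^ 2) := by
    intro k
    refine setIntegral_congr_fun isClosed_frontier.measurableSet fun x hx => ?_
    have h2 : GMsFEM.modalTail (m k) (d k) (z k) ∈ GMsFEM.femSpaceZero (block k) :=
      GMsFEM.modalTail_mem _ _ (hz k).mem
    simp only [(hcd k).eqOn_error (p k) (m k) (GMsFEM.frontier_subset_region _ hx), Pi.add_apply,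
      h2.2 x hx, add_zero]
  have hjump := hblock.jump_le hA hcont
  simp only [htrace] at hjump
  have main : GMsFEM.aNormSq M block a γ h (fun k => uh t -
        (GMsFEM.modalSum (p k) (c k) (w k) + GMsFEM.modalSum (m k) (d k) (z k)))
      ≤ ∑ k, (H * GMsFEM.recipNext (mu k) (p k) *
            (1 + 2 * a₁ * γ * H / h * GMsFEM.recipNext (mu k) (p k)) *
            GMsFEM.bdryIntegral (block k) (fun x => q k x ^ 2) +
          H ^ 2 * GMsFEM.recipNext (lam k) (m k) *
            ∫ x in GMsFEM.region (block k), (f t x - uh_tt t x) ^ 2) := by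
    refine (add_le_add le_rfl (mul_le_mul_of_nonneg_left hjump (by positivity))).trans ?_
    rw [Finset.mul_sum, Finset.mul_sum, ← Finset.sum_add_distrib]
    refine Finset.sum_le_sum fun k _ => ?_
    rw [GMsFEM.energy_error (hA k) (hw k) (hz k) (hcd k)]
    have h1 : γ / h * (2 * a₁ * GMsFEM.bdryIntegral (block k)
        (fun x => GMsFEM.modalTail (p k) (c k) (w k) x ^ 2)) ≤
        γ / h * (2 * a₁ * ((H * GMsFEM.recipNext (mu k) (p k)) ^ 2 *
          GMsFEM.bdryIntegral (block k) (fun x => q k x ^ 2))) := by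
      have := ha₁ k
      have := (hT1 k).2
      gcongr
    refine (add_le_add (add_le_add (hT1 k).1 (hT2 k)) h1).trans (le_of_eq ?_)
    ring
  refine ⟨main, main.trans (Finset.sum_le_sum fun k _ => add_le_add ?_ (le_of_eq (by ring)))⟩
  -- For the rate, the reciprocal inside the bracket is replaced by its value at `1`, that is
  -- $1/\mu_2$, which is legitimate since $p\ge1$; the outer reciprocal is kept.
  have hmono := GMsFEM.recipNext_antitone (hw k).ordered ((hw k).nonneg (hA k) hH)
    (fun i hi => (hw k).pos (hA k) hH i hi) (hp k).1
  have := ha₁ k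
  have := hr0 k (p k)
  have := hQ0 k
  calc _ ≤ H * GMsFEM.recipNext (mu k) (p k) *
            (1 + 2 * a₁ * γ * H / h * GMsFEM.recipNext (mu k) 1) *
            GMsFEM.bdryIntegral (block k) (fun x => q k x ^ 2) := by gcongr
    _ = _ := by ring
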